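/- **Definitions.** A *geometric $(n_k)$ configuration* is a set of $n$ points and $n$ straight lines in the Euclidean plane $\mathbb{E}^2$ such that each line passes through exactly $k$ of the points and each point lies on exactly $k$ of the lines; configurations in the extended Euclidean (real projective) plane $\mathbb{E}^{2+}$ are defined in the same way. The celestial configuration $m\#(s_1,t_1;\dots;s_h,t_h)$ is built as follows: $(v_0)_i$, $i\in\mathbb{Z}_m$, are the consecutive vertices of a regular $m$-gon; for $j=0,\dots,h-1$ the line $(L_j)_i$ joins $(v_j)_i$ and $(v_j)_{i+s_{j+1}}$, and $(v_{j+1})_i$ is the intersection point of $(L_j)_i$ and $(L_j)_{i-t_{j+1}}$; the symbol is admissible if $(v_h)_i=(v_0)_{i+\delta}$ for all $i$, where $\delta=\frac12\sum_j(s_j-t_j)$, and the points $(v_j)_i$ and lines $(L_j)_i$ with $0\le j<h$ form an $((mh)_4)$ configuration. A *diameter* is a line through the center and one of the points $(v_0)_i$. A configuration in $\mathbb{E}^2$ *has independent pencils of $p$ and $q$ parallel lines* if it contains $p$ mutually parallel lines and $q$ mutually parallel lines of a different direction such that no point of the configuration lies on a line of both families. **Lemma.** Let $\ell\ge 5$ and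 let $m=2\ell+1$. Then $m\#(5,1;2,3;4,5;1,2;3,4)$ is a celestial $((5m)_4)$ configuration, with twist $\delta=0$. Choose the coordinates so that $(v_0)_i=\bigl(\cos(\tfrac{\pi}{2}+\tfrac{2\pi i}{m}),\,\sin(\tfrac{\pi}{2}+\tfrac{2\pi i}{m})\bigr)$. Adding to it all $m$ diameters and the $m$ points at infinity in the directions $\frac{2i\pi}{m}$ gives a $((12\ell+6)_5)$ configuration $\mathcal{D}_5(\ell)$ in $\mathbb{E}^{2+}$. There are projective transformations that map all points of $\mathcal{D}_5(\ell)$ into $\mathbb{E}^2$, and each of them maps $\mathcal{D}_5(\ell)$ to a geometric $((12\ell+6)_5)$ configuration in $\mathbb{E}^2$ that has independent pencils of $p=1$ and $q=1$ lines. Moreover, the transformation can be chosen such that no two distinct lines of the image are parallel, so that $p=q=1$ are then the largest possible sizes of such pencils. -/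

import Mathlib

noncomputable section

namespace DFive

/-! ### Configurations -/

/-- `n` points and `n` lines such that every line passes through exactly `k` of the points and
every point lies on exactly `k` of the lines. -/
def IsConfiguration {P L : Type*} (inc : P → L → Prop) (n k : ℕ)
    (pts : Set P) (lns : Set L) : Prop :=
  pts.Finite ∧ lns.Finite ∧ pts.ncard = n ∧ lns.ncard = n ∧
    (∀ l ∈ lns, {p ∈ pts | inc p l}.ncard = k) ∧
    (∀ p ∈ pts, {l ∈ lns | inc p l}.ncard = k)

/-- The Euclidean plane. -/
abbrev E2 : Type := EuclideanSpace ℝ (Fin 2)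

/-- A geometric `(n_k)` configuration: points and straight lines of the Euclidean plane. -/
def IsGeometricConfiguration (n k : ℕ) (pts : Set E2) (lns : Set (AffineSubspace ℝ E2)) : Prop :=
  (∀ l ∈ lns, (l : Set E2).Nonempty ∧ Module.finrank ℝ l.direction = 1) ∧
    IsConfiguration (fun p l => p ∈ l) n k pts lns

/-- The configuration contains two independent pencils, of `p` and of `q` parallel lines: the lines
within each pencil are parallel, the two pencils have different directions, and no point of the
configuration lies on a line of both pencils. -/
def HasIndependentPencils (p q : ℕ) (pts : Set E2) (lns : Set (AffineSubspace ℝ E2)) : Prop :=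
  ∃ P Q : Finset (AffineSubspace ℝ E2), (P : Set (AffineSubspace ℝ E2)) ⊆ lns ∧
    (Q : Set (AffineSubspace ℝ E2)) ⊆ lns ∧ P.card = p ∧ Q.card = q ∧
    (∀ a ∈ P, ∀ b ∈ P, a.Parallel b) ∧ (∀ a ∈ Q, ∀ b ∈ Q, a.Parallel b) ∧
    (∀ a ∈ P, ∀ b ∈ Q, ¬ a.Parallel b) ∧
    (∀ x ∈ pts, ∀ a ∈ P, ∀ b ∈ Q, ¬ (x ∈ a ∧ x ∈ b))

/-! ### The extended Euclidean plane

The extended Euclidean plane is the projective plane of `ℝ³`: its points are the one-dimensional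
and its lines the two-dimensional subspaces, incidence is inclusion, the join of two points is
their supremum, and the meet of two lines is their infimum. -/

/-- The lattice of subspaces of `ℝ³`. -/
abbrev Flat : Type := Submodule ℝ (Fin 3 → ℝ)

/-- An `(n_k)` configuration in the extended Euclidean plane. -/
def IsExtendedConfiguration (n k : ℕ) (pts lns : Set Flat) : Prop :=
  (∀ p ∈ pts, Module.finrank ℝ p = 1) ∧ (∀ l ∈ lns, Module.finrank ℝ l = 2) ∧
    IsConfiguration (fun p l : Flat => p ≤ l) n k pts lns

/-- The line at infinity. -/
def lineAtInfinity : Flat := LinearMap.ker (LinearMap.proj 2 : (Fin 3 → ℝ) →ₗ[ℝ] ℝ)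

/-- The point of the extended plane with Cartesian coordinates `(x, y)`. -/
def ordinaryPoint (x y : ℝ) : Flat := Submodule.span ℝ {![x, y, 1]}

/-- The point at infinity in the direction that makes the angle `θ` with the first axis. -/
def pointAtInfinity (θ : ℝ) : Flat := Submodule.span ℝ {![Real.cos θ, Real.sin θ, 0]}

/-- The points of the Euclidean plane that belong to a set of points of the extended plane. -/
def affinePoints (pts : Set Flat) : Set E2 := {x | ordinaryPoint (x 0) (x 1) ∈ pts}

/-- The set of all points of the Euclidean plane on a line of the extended plane. -/
def affineLine (W : Flat) : AffineSubspace ℝ E2 where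
  carrier := {x | ![x 0, x 1, 1] ∈ W}
  smul_vsub_vadd_mem' := by
    intro c x y z hx hy hz
    have h := W.add_mem (W.smul_mem c (W.sub_mem hx hy)) hz
    have e : (![(c • (x -ᵥ y) +ᵥ z) 0, (c • (x -ᵥ y) +ᵥ z) 1, 1] : Fin 3 → ℝ)
        = c • (![x 0, x 1, 1] - ![y 0, y 1, 1]) + ![z 0, z 1, 1] := by
      ext i
      fin_cases i <;> simp
    change (![(c • (x -ᵥ y) +ᵥ z) 0, (c • (x -ᵥ y) +ᵥ z) 1, 1] : Fin 3 → ℝ) ∈ W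
    rw [e]
    exact h

/-- The lines of the Euclidean plane given by a set of lines of the extended plane. -/
def affineLines (lns : Set Flat) : Set (AffineSubspace ℝ E2) := affineLine '' lns

/-- A projective transformation of the extended plane, induced by a linear automorphism of `ℝ³`,
applied to a set of points or to a set of lines. -/
def projImage (f : (Fin 3 → ℝ) ≃ₗ[ℝ] (Fin 3 → ℝ)) (S : Set Flat) : Set Flat :=
  (fun W => Submodule.map (f : (Fin 3 → ℝ) →ₗ[ℝ] (Fin 3 → ℝ)) W) '' S

/-- The projective transformation moves all the given points into the Euclidean plane. -/
def ProjectsIntoPlane (f : (Fin 3 → ℝ) ≃ₗ[ℝ] (Fin 3 → ℝ)) (pts : Set Flat) : Prop :=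
  ∀ p ∈ projImage f pts, ¬ p ≤ lineAtInfinity

/-! ### Celestial configurations

The symbol `m#(s₁,t₁;…;s_h,t_h)` is given by `m` and the list of the pairs `(s_j, t_j)`, indexed
from `0`. The second index of a point or a line is an integer that matters only modulo `m`. -/

/-- Vertices of the regular `m`-gon on the unit circle, placed with vertex `0` in the direction of
the second axis. -/
def vertex (m : ℕ) (i : ℤ) : Flat :=
  ordinaryPoint (Real.cos (Real.pi / 2 + 2 * Real.pi * i / m))
    (Real.sin (Real.pi / 2 + 2 * Real.pi * i / m))

/-- The points `(v_j)_i`: class `0` is the regular `m`-gon, and `(v_{j+1})_i` is the meet of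
`(L_j)_i` and `(L_j)_{i-t_j}`, where `(L_j)_i` is the join of `(v_j)_i` and `(v_j)_{i+s_j}`. -/
def celestialPoint (m : ℕ) (sym : List (ℤ × ℤ)) : ℕ → ℤ → Flat
  | 0, i => vertex m i
  | j + 1, i =>
    (celestialPoint m sym j i ⊔ celestialPoint m sym j (i + (sym.getD j (0, 0)).1)) ⊓
      (celestialPoint m sym j (i - (sym.getD j (0, 0)).2) ⊔
        celestialPoint m sym j (i - (sym.getD j (0, 0)).2 + (sym.getD j (0, 0)).1))

/-- The line `(L_j)_i`, the join of `(v_j)_i` and `(v_j)_{i+s_j}`. -/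
def celestialLine (m : ℕ) (sym : List (ℤ × ℤ)) (j : ℕ) (i : ℤ) : Flat :=
  celestialPoint m sym j i ⊔ celestialPoint m sym j (i + (sym.getD j (0, 0)).1)

/-- All points of the construction with the given symbol. -/
def celestialPoints (m : ℕ) (sym : List (ℤ × ℤ)) : Set Flat :=
  {p | ∃ j < sym.length, ∃ i : ℤ, p = celestialPoint m sym j i}

/-- All lines of the construction with the given symbol. -/
def celestialLines (m : ℕ) (sym : List (ℤ × ℤ)) : Set Flat :=
  {l | ∃ j < sym.length, ∃ i : ℤ, l = celestialLine m sym j i}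

/-- Rotation of the extended plane about the origin by the angle `θ`. -/
def rotation (θ : ℝ) : (Fin 3 → ℝ) →ₗ[ℝ] (Fin 3 → ℝ) :=
  Matrix.toLin' !![Real.cos θ, -Real.sin θ, 0; Real.sin θ, Real.cos θ, 0; 0, 0, 1]

/-- The construction with the given symbol really yields a celestial 4-configuration, that is, an
`((mh)_4)` configuration of ordinary points, on whose `h` classes of points and of lines the
rotation by `2π/m` acts by `i ↦ i + 1`, with the incidences of the reduced Levi graph: `(L_j)_i`
passes through `(v_j)_i`, `(v_j)_{i+s_j}`, `(v_{j+1})_i`, `(v_{j+1})_{i+t_j}`, where `(v_h)_i` is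
`(v_0)_{i+δ}` for the twist `δ = ½ ∑ (s_j - t_j)`. -/
structure IsCelestial (m : ℕ) (sym : List (ℤ × ℤ)) : Prop where
  config : IsExtendedConfiguration (m * sym.length) 4 (celestialPoints m sym)
    (celestialLines m sym)
  ordinary : ∀ p ∈ celestialPoints m sym, ¬ p ≤ lineAtInfinity
  rotate_point : ∀ j < sym.length, ∀ i : ℤ,
    (celestialPoint m sym j i).map (rotation (2 * Real.pi / m)) = celestialPoint m sym j (i + 1)
  rotate_line : ∀ j < sym.length, ∀ i : ℤ,
    (celestialLine m sym j i).map (rotation (2 * Real.pi / m)) = celestialLine m sym j (i + 1)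
  incidence : ∀ j < sym.length, ∀ i : ℤ,
    celestialPoint m sym j i ≤ celestialLine m sym j i ∧
    celestialPoint m sym j (i + (sym.getD j (0, 0)).1) ≤ celestialLine m sym j i ∧
    celestialPoint m sym (j + 1) i ≤ celestialLine m sym j i ∧
    celestialPoint m sym (j + 1) (i + (sym.getD j (0, 0)).2) ≤ celestialLine m sym j i
  closing : ∃ δ : ℤ, 2 * δ = (sym.map fun a => a.1 - a.2).sum ∧
    ∀ i : ℤ, celestialPoint m sym sym.length i = celestialPoint m sym 0 (i + δ)

/-- The diameter through `(v_0)_i`: its join with the center. -/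
def diameter (m : ℕ) (i : ℤ) : Flat := vertex m i ⊔ ordinaryPoint 0 0

/-- The symbol `(5,1;2,3;4,5;1,2;3,4)`. -/
def symbolD5 : List (ℤ × ℤ) := [(5, 1), (2, 3), (4, 5), (1, 2), (3, 4)]

/-- Points of the construction: the points of the celestial configuration
`(2ℓ+1)#(5,1;2,3;4,5;1,2;3,4)` and the points at infinity in the directions `2iπ/(2ℓ+1)`. -/
def D5Points (ℓ : ℕ) : Set Flat :=
  celestialPoints (2 * ℓ + 1) symbolD5 ∪
    {p | ∃ i : ℤ, p = pointAtInfinity (2 * i * Real.pi / (2 * ℓ + 1))}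

/-- Lines of the construction: the lines of the celestial configuration
`(2ℓ+1)#(5,1;2,3;4,5;1,2;3,4)` and all diameters. -/
def D5Lines (ℓ : ℕ) : Set Flat :=
  celestialLines (2 * ℓ + 1) symbolD5 ∪ {l | ∃ i : ℤ, l = diameter (2 * ℓ + 1) i}

end DFive

end

/-! Put every point and line in homogeneous coordinates. With the angle `π / m` as half step, class
`k` of points lies on a circle of radius `radius m k`, turned by `pointShift k` half steps, and
class `j` of lines is tangent to a circle of radius `distance m j`, its normals turned by `lineShift
j`. A point is on a line exactly when `r * cos (n * π / m) = d`, where `n` is the difference of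
their angles in half steps. One step of the celestial construction multiplies the radius by `cos (s
π / m) / cos (t π / m)` and adds `s - t` to the shift. The entries `s` and the entries `t` are both
1, 2, 3, 4, 5 in some order, so after five steps radius and shift are back at 1 and 0: the
construction closes with twist 0.

The hard part is to exclude accidental incidences. For each of the 15 other pairs of classes,
`radius_mul_cosMul_ne` shows that `d` exceeds `r` or lies strictly between two consecutive values of
`r * cos` of the right parity. Diameters and points at infinity need only divisibility by the odd
number `m`. Thus `pt_le_ln_iff` describes all incidences by a cyclic voltage table with row and
column sums 5, and the counting and distinctness statements are read off that table.

Projective images: incidences survive, and every line has two points that stay finite, so the image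
is a geometric configuration. The line `(L_0)_0` meets two diameters in different points outside the
configuration; a map that keeps the configuration points finite cannot send both meets to infinity,
so one diameter gives the independent pencils. A generic map sends neither a point nor a meet of two
lines to infinity, so it leaves no parallels. -/

noncomputable section

namespace DFive

open Real

/-! ### Configurations with a cyclic symmetry -/

section Cyclic

variable {P L C : Type*} {m : ℕ} {inc : P → L → Prop} {p : C → ℤ → P} {l : C → ℤ → L}
  {E : C → C → Finset (ZMod m)}

/-- If incidence between the classes of points and lines is governed by a voltage table that
separates the classes of points, then a point determines its class and its index. -/
theorem point_eq_iff
    (hper : ∀ k (b b' : ℤ), (b : ZMod m) = b' → p k b = p k b')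
    (hinc : ∀ k j (b a : ℤ), inc (p k b) (l j a) ↔ (b : ZMod m) - a ∈ E k j)
    (hsep : ∀ k k', (∀ j, (E k j).Nonempty ↔ (E k' j).Nonempty) → k = k')
    (hone : ∀ k, ∃ j, (E k j).card = 1) (k k' : C) (b b' : ℤ) :
    p k b = p k' b' ↔ k = k' ∧ (b : ZMod m) = b' := by
  constructor
  · intro h
    have key : ∀ j (a : ZMod m), (b : ZMod m) - a ∈ E k j ↔ (b' : ZMod m) - a ∈ E k' j := by
      intro j a
      obtain ⟨a, rfl⟩ := ZMod.intCast_surjective a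
      rw [← hinc, ← hinc, h]
    have hk : k = k' := by
      refine hsep k k' fun j => ⟨?_, ?_⟩
      · rintro ⟨c, hc⟩
        exact ⟨_, (key j (b - c)).1 (by simpa using hc)⟩
      · rintro ⟨c, hc⟩
        exact ⟨_, (key j (b' - c)).2 (by simpa using hc)⟩
    subst hk
    refine ⟨rfl, ?_⟩
    obtain ⟨j, hj⟩ := hone k
    obtain ⟨c, hc⟩ := Finset.card_eq_one.1 hj
    have := (key j (b - c)).1 (by simp [hc])
    rw [hc, Finset.mem_singleton] at this
    linear_combination -this
  · rintro ⟨rfl, h⟩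
    exact hper k b b' h

/-- The number of points of a cyclic family on one of its lines. -/
theorem ncard_points_on_line [Fintype C] [NeZero m]
    (hp : ∀ k k' (b b' : ℤ), p k b = p k' b' ↔ k = k' ∧ (b : ZMod m) = b')
    (hinc : ∀ k j (b a : ℤ), inc (p k b) (l j a) ↔ (b : ZMod m) - a ∈ E k j) (j : C) (a : ℤ) :
    {q ∈ {q | ∃ k b, q = p k b} | inc q (l j a)}.ncard = ∑ k, (E k j).card := by
  classical
  let F : (Σ _ : C, ZMod m) → P := fun x => p x.1 ((x.2 + (a : ZMod m)).val : ℤ)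
  have hF : Function.Injective F := by
    rintro ⟨k, c⟩ ⟨k', c'⟩ h
    obtain ⟨rfl, h⟩ := (hp _ _ _ _).1 h
    simpa using h
  have hset : {q ∈ {q | ∃ k b, q = p k b} | inc q (l j a)}
      = F '' ((Finset.univ.sigma fun k => E k j : Finset (Σ _ : C, ZMod m)) : Set _) := by
    ext q
    constructor
    · rintro ⟨⟨k, b, rfl⟩, h⟩
      refine ⟨⟨k, (b : ZMod m) - a⟩, ?_, ?_⟩
      · simpa [hinc] using h
      · simp [F, hp]
    · rintro ⟨⟨k, c⟩, h, rfl⟩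
      refine ⟨⟨k, _, rfl⟩, ?_⟩
      rw [hinc]
      simpa using h
  rw [hset, Set.ncard_image_of_injective _ hF, Set.ncard_coe_finset, Finset.card_sigma]

/-- The number of members of a cyclic family. -/
theorem ncard_cyclic_family [Fintype C] [NeZero m]
    (hp : ∀ k k' (b b' : ℤ), p k b = p k' b' ↔ k = k' ∧ (b : ZMod m) = b') :
    {q | ∃ k b, q = p k b}.Finite ∧ {q | ∃ k b, q = p k b}.ncard = Fintype.card C * m := by
  let F : C × ZMod m → P := fun x => p x.1 (x.2.val : ℤ)
  have hF : Function.Injective F := by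
    rintro ⟨k, c⟩ ⟨k', c'⟩ h
    obtain ⟨rfl, h⟩ := (hp _ _ _ _).1 h
    simpa using h
  have hset : {q | ∃ k b, q = p k b} = Set.range F := by
    ext q
    constructor
    · rintro ⟨k, b, rfl⟩
      exact ⟨(k, b), by simp [F, hp]⟩
    · rintro ⟨x, rfl⟩
      exact ⟨_, _, rfl⟩
  rw [hset]
  refine ⟨Set.finite_range F, ?_⟩
  rw [← Set.image_univ, Set.ncard_image_of_injective _ hF, Set.ncard_univ, Nat.card_prod,
    Nat.card_eq_fintype_card, Nat.card_zmod]

/-- A voltage table with constant row and column sums gives a configuration. -/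
theorem isConfiguration_of_cyclic [Fintype C] [NeZero m] {n : ℕ}
    (hp : ∀ k k' (b b' : ℤ), p k b = p k' b' ↔ k = k' ∧ (b : ZMod m) = b')
    (hl : ∀ k k' (b b' : ℤ), l k b = l k' b' ↔ k = k' ∧ (b : ZMod m) = b')
    (hinc : ∀ k j (b a : ℤ), inc (p k b) (l j a) ↔ (b : ZMod m) - a ∈ E k j)
    (hcol : ∀ j, ∑ k, (E k j).card = n) (hrow : ∀ k, ∑ j, (E k j).card = n) :
    IsConfiguration inc (Fintype.card C * m) n {q | ∃ k b, q = p k b} {q | ∃ k b, q = l k b} := by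
  refine ⟨(ncard_cyclic_family hp).1, (ncard_cyclic_family hl).1, (ncard_cyclic_family hp).2,
    (ncard_cyclic_family hl).2, ?_, ?_⟩
  · rintro _ ⟨j, a, rfl⟩
    rw [ncard_points_on_line hp hinc, hcol]
  · rintro _ ⟨k, b, rfl⟩
    -- Lines through a point are counted by duality: exchanging the roles transposes the table and
    -- negates the voltages.
    have hinc' : ∀ j k (a b : ℤ), (fun x y => inc y x) (l j a) (p k b) ↔
        (a : ZMod m) - b ∈ (E k j).map (Equiv.neg (ZMod m)).toEmbedding := by
      intro j k a b
      simp only [hinc, Finset.mem_map_equiv]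
      simp
    have := ncard_points_on_line (inc := fun x y => inc y x) hl hinc' k b
    simp only [Finset.card_map] at this
    rw [hrow] at this
    exact this

end Cyclic

/-! ### Joins and meets in the projective plane -/

theorem sup_eq_of_finrank {p q l : Flat} (hp : Module.finrank ℝ p = 1)
    (hq : Module.finrank ℝ q = 1) (hl : Module.finrank ℝ l = 2) (hpq : p ≠ q)
    (hpl : p ≤ l) (hql : q ≤ l) : p ⊔ q = l := by
  refine Submodule.eq_of_le_of_finrank_le (sup_le hpl hql) ?_
  rw [hl]
  by_contra h
  have h1 : p = p ⊔ q := Submodule.eq_of_le_of_finrank_le le_sup_left (by omega)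
  have h2 : q = p ⊔ q := Submodule.eq_of_le_of_finrank_le le_sup_right (by omega)
  exact hpq (h1.trans h2.symm)

theorem finrank_inf_of_ne {l l' : Flat} (hl : Module.finrank ℝ l = 2)
    (hl' : Module.finrank ℝ l' = 2) (h : l ≠ l') :
    Module.finrank ℝ (l ⊓ l' : Flat) = 1 := by
  have h1 := Submodule.finrank_sup_add_finrank_inf_eq l l'
  have h2 : Module.finrank ℝ (l ⊔ l' : Flat) ≤ 3 := by
    simpa using Submodule.finrank_le (l ⊔ l')
  have h3 : ¬ Module.finrank ℝ (l ⊔ l' : Flat) ≤ 2 := by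
    intro h3
    have h4 : l = l ⊔ l' := Submodule.eq_of_le_of_finrank_le le_sup_left (by omega)
    have h5 : l' = l ⊔ l' := Submodule.eq_of_le_of_finrank_le le_sup_right (by omega)
    exact h (h4.trans h5.symm)
  omega

theorem inf_eq_of_finrank {p l l' : Flat} (hp : Module.finrank ℝ p = 1)
    (hl : Module.finrank ℝ l = 2) (hl' : Module.finrank ℝ l' = 2) (h : l ≠ l')
    (hpl : p ≤ l) (hpl' : p ≤ l') : l ⊓ l' = p :=
  (Submodule.eq_of_le_of_finrank_le (le_inf hpl hpl')
    (by rw [hp, finrank_inf_of_ne hl hl' h])).symm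

/-- The line with the homogeneous coordinates `n`. -/
def lineOf (n : Fin 3 → ℝ) : Flat := LinearMap.ker (dotProductBilin ℝ ℝ n)

theorem mem_lineOf {n v : Fin 3 → ℝ} : v ∈ lineOf n ↔ n 0 * v 0 + n 1 * v 1 + n 2 * v 2 = 0 := by
  simp [lineOf, dotProduct, Fin.sum_univ_three]

theorem span_le_lineOf {n v : Fin 3 → ℝ} :
    Submodule.span ℝ {v} ≤ lineOf n ↔ n 0 * v 0 + n 1 * v 1 + n 2 * v 2 = 0 := by
  rw [Submodule.span_singleton_le_iff_mem, mem_lineOf]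

theorem finrank_lineOf {n : Fin 3 → ℝ} (hn : n ≠ 0) : Module.finrank ℝ (lineOf n) = 2 := by
  have h := Module.Dual.finrank_ker_add_one_of_ne_zero
    (f := (dotProductBilin ℝ ℝ n : (Fin 3 → ℝ) →ₗ[ℝ] ℝ)) (by
      intro h
      apply hn
      have := LinearMap.congr_fun h n
      simpa [dotProduct_self_eq_zero] using this)
  simp only [Module.finrank_fin_fun] at h
  unfold lineOf
  omega

/-! ### Cosines of multiples of `π / m` -/

/-- The cosine of `n` times the angle `π / m`. -/
def cosMul (m : ℕ) (n : ℤ) : ℝ := cos (n * (π / m))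

theorem cosMul_mul (m : ℕ) (a b : ℤ) :
    cosMul m a * cosMul m b = (cosMul m (a + b) + cosMul m (a - b)) / 2 := by
  simp only [cosMul]
  push_cast
  rw [add_mul, sub_mul, cos_add, cos_sub]
  ring

theorem cosMul_zero (m : ℕ) : cosMul m 0 = 1 := by simp [cosMul]

theorem cosMul_lt {m : ℕ} {a b : ℤ} (ha : 0 ≤ a) (hab : a < b) (hb : b ≤ m) :
    cosMul m b < cosMul m a := by
  have hm : (0 : ℝ) < m := by
    have : (0 : ℤ) < m := by omega
    exact_mod_cast this
  have hx : 0 < π / m := div_pos pi_pos hm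
  refine cos_lt_cos_of_nonneg_of_le_pi ?_ ?_ ?_
  · have : (0 : ℝ) ≤ a := by exact_mod_cast ha
    positivity
  · have : (b : ℝ) ≤ m := by exact_mod_cast hb
    calc (b : ℝ) * (π / m) ≤ m * (π / m) := by gcongr
      _ = π := by field_simp
  · have : (a : ℝ) < b := by exact_mod_cast hab
    gcongr

theorem cosMul_pos {m : ℕ} {a : ℤ} (ha : 0 ≤ a) (ham : 2 * a < m) : 0 < cosMul m a := by
  have hm : (0 : ℝ) < m := by
    have : (0 : ℤ) < m := by omega
    exact_mod_cast this
  have hx : 0 < π / m := div_pos pi_pos hm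
  have ha' : (0 : ℝ) ≤ a := by exact_mod_cast ha
  have ham' : 2 * (a : ℝ) < m := by exact_mod_cast ham
  refine cos_pos_of_mem_Ioo ⟨?_, ?_⟩
  · have : 0 ≤ (a : ℝ) * (π / m) := by positivity
    linarith [pi_pos]
  · have : 2 * (a : ℝ) * (π / m) < m * (π / m) := by gcongr
    have e : (m : ℝ) * (π / m) = π := by field_simp
    linarith

theorem cosMul_eq_iff {m : ℕ} (hm : m ≠ 0) (n a : ℤ) :
    cosMul m n = cosMul m a ↔ (2 * m : ℤ) ∣ n - a ∨ (2 * m : ℤ) ∣ n + a := by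
  have hm' : (m : ℝ) ≠ 0 := by exact_mod_cast hm
  have key : ∀ u k : ℤ, (u : ℝ) * (π / m) = 2 * k * π ↔ u = 2 * m * k := by
    intro u k
    rw [mul_div_assoc', div_eq_iff hm']
    constructor
    · intro h
      have : (u : ℝ) = 2 * m * k := mul_right_cancel₀ pi_ne_zero (by linear_combination h)
      exact_mod_cast this
    · intro h
      rw [h]
      push_cast
      ring
  rw [cosMul, cosMul, cos_eq_cos_iff]
  constructor
  · rintro ⟨k, h | h⟩
    · left
      refine ⟨-k, (key _ _).1 ?_⟩
      push_cast
      linear_combination -h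
    · right
      refine ⟨k, (key _ _).1 ?_⟩
      push_cast
      linear_combination h
  · rintro (⟨k, h⟩ | ⟨k, h⟩)
    · refine ⟨-k, Or.inl ?_⟩
      have := (key _ _).2 h
      push_cast at this ⊢
      linear_combination -this
    · refine ⟨k, Or.inr ?_⟩
      have := (key _ _).2 h
      push_cast at this ⊢
      linear_combination this

theorem sin_mul_eq_zero_iff {m : ℕ} (hm : m ≠ 0) (n : ℤ) :
    sin (n * (π / m)) = 0 ↔ (m : ℤ) ∣ n := by
  have hm' : (m : ℝ) ≠ 0 := by exact_mod_cast hm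
  rw [sin_eq_zero_iff]
  constructor
  · rintro ⟨k, h⟩
    refine ⟨k, ?_⟩
    rw [mul_div_assoc', eq_div_iff hm'] at h
    have : (n : ℝ) = m * k := mul_right_cancel₀ pi_ne_zero (by linear_combination -h)
    exact_mod_cast this
  · rintro ⟨k, rfl⟩
    refine ⟨k, ?_⟩
    push_cast
    field_simp

/-- Multiples of `π / m` of a fixed parity have no cosine strictly between two consecutive
values. -/
theorem cosMul_ne_of_between {m : ℕ} {a n : ℤ} {r d : ℝ} (ha : 0 ≤ a) (ham : a + 2 ≤ m)
    (hr : 0 < r) (hn : (2 : ℤ) ∣ n - a) (h1 : d < r * cosMul m a)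
    (h2 : r * cosMul m (a + 2) < d) : r * cosMul m n ≠ d := by
  intro h
  have hm : 0 < m := by omega
  -- Reduction modulo `2 * m` and reflection bring the angle into `[0, π]`, where cosine is strictly
  -- decreasing. The modulus is even, so parity is kept and `e` cannot be `a + 1`.
  obtain ⟨e, he, he0, hem⟩ : ∃ e : ℤ, ((2 * m : ℤ) ∣ n - e ∨ (2 * m : ℤ) ∣ n + e) ∧
      0 ≤ e ∧ e ≤ m := by
    have h3 := Int.emod_nonneg n (b := 2 * m) (by omega)
    have h4 := Int.emod_lt_of_pos n (b := 2 * m) (by omega)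
    have h5 := Int.mul_ediv_add_emod n (2 * m)
    by_cases h6 : n % (2 * m) ≤ m
    · exact ⟨n % (2 * m), Or.inl ⟨n / (2 * m), by linarith⟩, h3, h6⟩
    · exact ⟨2 * m - n % (2 * m), Or.inr ⟨n / (2 * m) + 1, by linarith⟩, by omega, by omega⟩
  have hpar : (2 : ℤ) ∣ e - a := by
    have h2m : (2 : ℤ) ∣ 2 * m := ⟨m, rfl⟩
    rcases he with he | he
    · have := h2m.trans he
      omega
    · have := h2m.trans he
      omega
  rw [(cosMul_eq_iff hm.ne' n e).2 he] at h
  rcases lt_trichotomy e a with h6 | h6 | h6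
  · have := cosMul_lt he0 h6 (by omega : a ≤ m)
    nlinarith
  · subst h6
    linarith
  · rcases (show a + 2 ≤ e by omega).eq_or_lt with h7 | h7
    · subst h7
      linarith
    · have := cosMul_lt (by omega) h7 hem
      nlinarith

theorem cosMul_ne_of_lt {m : ℕ} {n : ℤ} {r d : ℝ} (hr : 0 < r) (h : r < d) :
    r * cosMul m n ≠ d := by
  have : cosMul m n ≤ 1 := cos_le_one _
  nlinarith

/-! ### Radii and distances of the classes -/

/-- Number of the half steps by which class `k` of points is turned against class `0`. -/
def pointShift : Fin 5 → ℤ := ![0, 4, 3, 2, 1]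

/-- Number of the half steps by which the normals of class `j` of lines are turned. -/
def lineShift : Fin 5 → ℤ := ![5, 6, 7, 3, 4]

/-- The entries `s` of the symbol. -/
def spanS : Fin 5 → ℤ := ![5, 2, 4, 1, 3]

/-- The entries `t` of the symbol. -/
def spanT : Fin 5 → ℤ := ![1, 3, 5, 2, 4]

/-- Distance of the points of class `k` from the center. -/
def radius (m : ℕ) : Fin 5 → ℝ :=
  ![1, cosMul m 5 / cosMul m 1, cosMul m 5 * cosMul m 2 / (cosMul m 1 * cosMul m 3),
    cosMul m 2 * cosMul m 4 / (cosMul m 1 * cosMul m 3), cosMul m 4 / cosMul m 3]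

/-- Distance of the lines of class `j` from the center. -/
def distance (m : ℕ) : Fin 5 → ℝ :=
  ![cosMul m 5, cosMul m 5 * cosMul m 2 / cosMul m 1,
    cosMul m 5 * cosMul m 2 * cosMul m 4 / (cosMul m 1 * cosMul m 3),
    cosMul m 2 * cosMul m 4 / cosMul m 3, cosMul m 4]

theorem radius_pos {m : ℕ} (hm : 11 ≤ m) (k : Fin 5) : 0 < radius m k := by
  have h1 : 0 < cosMul m 1 := cosMul_pos (by norm_num) (by omega)
  have h2 : 0 < cosMul m 2 := cosMul_pos (by norm_num) (by omega)
  have h3 : 0 < cosMul m 3 := cosMul_pos (by norm_num) (by omega)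
  have h4 : 0 < cosMul m 4 := cosMul_pos (by norm_num) (by omega)
  have h5 : 0 < cosMul m 5 := cosMul_pos (by norm_num) (by omega)
  fin_cases k <;> simp [radius] <;> positivity

/-- A chord spanning `s` steps of a regular `m`-gon of radius `r` has distance `r * cos (s * π / m)`
from the center. -/
theorem radius_mul_spanS {m : ℕ} (hm : 11 ≤ m) (j : Fin 5) :
    radius m j * cosMul m (spanS j) = distance m j := by
  have h1 : 0 < cosMul m 1 := cosMul_pos (by norm_num) (by omega)
  have h2 : 0 < cosMul m 2 := cosMul_pos (by norm_num) (by omega)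
  have h3 : 0 < cosMul m 3 := cosMul_pos (by norm_num) (by omega)
  fin_cases j <;> simp [radius, spanS, distance] <;> field_simp

/-- Here `j + 1` is cyclic in `Fin 5`; the case `j = 4` is the closing condition on the radii. -/
theorem radius_mul_spanT {m : ℕ} (hm : 11 ≤ m) (j : Fin 5) :
    radius m (j + 1) * cosMul m (spanT j) = distance m j := by
  have h1 : 0 < cosMul m 1 := cosMul_pos (by norm_num) (by omega)
  have h2 : 0 < cosMul m 2 := cosMul_pos (by norm_num) (by omega)
  have h3 : 0 < cosMul m 3 := cosMul_pos (by norm_num) (by omega)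
  fin_cases j <;> simp [radius, spanT, distance] <;> field_simp

/-- By product-to-sum, two products that share the sum or the difference of their indices differ in
a single cosine. -/
theorem cosMul_mul_lt {m : ℕ} {a b c d : ℤ} (h1 : a + b = c + d ∧ 0 ≤ c - d ∧ c - d < a - b ∧ a - b ≤ m ∨
    a - b = c - d ∧ 0 ≤ c + d ∧ c + d < a + b ∧ a + b ≤ m) :
    cosMul m a * cosMul m b < cosMul m c * cosMul m d := by
  rw [cosMul_mul, cosMul_mul]
  rcases h1 with ⟨e, h0, h1, h2⟩ | ⟨e, h0, h1, h2⟩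
  · have := cosMul_lt h0 h1 h2
    rw [e]
    linarith
  · have := cosMul_lt h0 h1 h2
    rw [e]
    linarith

/-- No accidental incidences. After clearing denominators each pair of classes needs one or two
inequalities between products of cosines, collected beforehand as the `i`, `j` and `l` facts. -/
theorem radius_mul_cosMul_ne {m : ℕ} (hm : 11 ≤ m) {k j : Fin 5} (hkj : k ≠ j)
    (hkj' : k ≠ j + 1) {n : ℤ} (hn : (2 : ℤ) ∣ n - (pointShift k - lineShift j)) :
    radius m k * cosMul m n ≠ distance m j := by
  have hr := radius_pos hm k
  have h1 : 0 < cosMul m 1 := cosMul_pos (by norm_num) (by omega)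
  have h2 : 0 < cosMul m 2 := cosMul_pos (by norm_num) (by omega)
  have h3 : 0 < cosMul m 3 := cosMul_pos (by norm_num) (by omega)
  have h4 : 0 < cosMul m 4 := cosMul_pos (by norm_num) (by omega)
  have h5 : 0 < cosMul m 5 := cosMul_pos (by norm_num) (by omega)
  have i42 : cosMul m 4 * cosMul m 2 < cosMul m 3 * cosMul m 1 := cosMul_mul_lt (by omega)
  have i31 : cosMul m 3 * cosMul m 1 < cosMul m 2 * cosMul m 2 := cosMul_mul_lt (by omega)
  have i51 : cosMul m 5 * cosMul m 1 < cosMul m 4 * cosMul m 2 := cosMul_mul_lt (by omega)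
  have i64 : cosMul m 6 * cosMul m 4 < cosMul m 5 * cosMul m 3 := cosMul_mul_lt (by omega)
  have i53 : cosMul m 5 * cosMul m 3 < cosMul m 4 * cosMul m 4 := cosMul_mul_lt (by omega)
  have i61 : cosMul m 6 * cosMul m 1 < cosMul m 5 * cosMul m 2 := cosMul_mul_lt (by omega)
  have i52 : cosMul m 5 * cosMul m 2 < cosMul m 4 * cosMul m 1 := cosMul_mul_lt (by omega)
  have i41 : cosMul m 4 * cosMul m 1 < cosMul m 3 * cosMul m 2 := cosMul_mul_lt (by omega)
  have i53' : cosMul m 5 * cosMul m 3 < cosMul m 4 * cosMul m 2 := cosMul_mul_lt (by omega)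
  have i42' : cosMul m 4 * cosMul m 2 < cosMul m 3 * cosMul m 3 := cosMul_mul_lt (by omega)
  have l32 : cosMul m 3 < cosMul m 2 := cosMul_lt (by norm_num) (by norm_num) (by omega)
  have l53 : cosMul m 5 < cosMul m 3 := cosMul_lt (by norm_num) (by norm_num) (by omega)
  have l51 : cosMul m 5 < cosMul m 1 := cosMul_lt (by norm_num) (by norm_num) (by omega)
  have l97 : cosMul m 9 < cosMul m 7 := cosMul_lt (by norm_num) (by norm_num) (by omega)
  have p41 : cosMul m 4 * cosMul m 1 = (cosMul m 5 + cosMul m 3) / 2 := cosMul_mul m 4 1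
  -- Fully linearised, this says that the cosines of indices 9 and 5 sum to less than those of
  -- indices 7 and 1.
  have j7 : cosMul m 7 * cosMul m 3 * cosMul m 1 < cosMul m 5 * cosMul m 4 * cosMul m 2 := by
    have e1 : cosMul m 7 * cosMul m 3 = (cosMul m 10 + cosMul m 4) / 2 := cosMul_mul m 7 3
    have e2 : cosMul m 5 * cosMul m 4 = (cosMul m 9 + cosMul m 1) / 2 := cosMul_mul m 5 4
    have e3 : cosMul m 10 * cosMul m 1 = (cosMul m 11 + cosMul m 9) / 2 := cosMul_mul m 10 1
    have e4 : cosMul m 9 * cosMul m 2 = (cosMul m 11 + cosMul m 7) / 2 := cosMul_mul m 9 2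
    have e5 : cosMul m 2 * cosMul m 1 = (cosMul m 3 + cosMul m 1) / 2 := cosMul_mul m 2 1
    rw [e1, e2]
    linarith
  have j5 : cosMul m 5 < cosMul m 4 * cosMul m 1 := by linarith
  have j52 : cosMul m 5 * cosMul m 2 < cosMul m 4 * cosMul m 1 * cosMul m 3 := by
    have e1 : cosMul m 7 * cosMul m 1 = (cosMul m 8 + cosMul m 6) / 2 := cosMul_mul m 7 1
    have e2 : cosMul m 1 * cosMul m 1 = (cosMul m 2 + 1) / 2 := by
      rw [cosMul_mul, sub_self, cosMul_zero]
      norm_num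
    have e3 : cosMul m 5 * cosMul m 3 = (cosMul m 8 + cosMul m 2) / 2 := cosMul_mul m 5 3
    have e4 : cosMul m 3 * cosMul m 3 = (cosMul m 6 + 1) / 2 := by
      rw [cosMul_mul, sub_self, cosMul_zero]
      norm_num
    have e5 : cosMul m 5 * cosMul m 2 = (cosMul m 7 + cosMul m 3) / 2 := cosMul_mul m 5 2
    have e6 : cosMul m 2 * cosMul m 1 = (cosMul m 3 + cosMul m 1) / 2 := cosMul_mul m 2 1
    have l10 : cosMul m 1 < 1 := by
      rw [← cosMul_zero m]
      exact cosMul_lt (by norm_num) (by norm_num) (by omega)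
    have l71 : cosMul m 7 < cosMul m 1 := cosMul_lt (by norm_num) (by norm_num) (by omega)
    -- Writing `c_i` for `cosMul m i`, the left side linearises to `1 + c_2 + c_6 + c_8 - 2 c_3 - 2
    -- c_7`. Using `c_6 + c_8 = 2 c_7 c_1` and expressing `c_2`, `c_3` through `c_1` makes the
    -- factor `1 - c_1` split off.
    have e7 : 4 * (cosMul m 4 * cosMul m 1 * cosMul m 3 - cosMul m 5 * cosMul m 2)
        = 2 * (1 - cosMul m 1) * (cosMul m 1 * (3 + 4 * cosMul m 1) - cosMul m 7) := by
      rw [p41, e5]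
      linear_combination 2 * e3 + 2 * e4 - 2 * e1 + (8 * cosMul m 1 - 2) * e2 + 4 * e6
    have : 0 < 2 * (1 - cosMul m 1) * (cosMul m 1 * (3 + 4 * cosMul m 1) - cosMul m 7) := by
      apply mul_pos
      · linarith
      · nlinarith
    linarith
  have j53 : cosMul m 5 * cosMul m 3 < cosMul m 4 * cosMul m 1 * cosMul m 2 :=
    mul_lt_mul'' j5 l32 h5.le h3.le
  have between : ∀ {r d : ℝ} (a : ℤ), 0 ≤ a → a ≤ 5 → 0 < r → (2 : ℤ) ∣ n - a →
      d < r * cosMul m a → r * cosMul m (a + 2) < d → r * cosMul m n ≠ d :=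
    fun a ha ha5 hr => cosMul_ne_of_between ha (by omega) hr
  fin_cases k <;> fin_cases j <;> simp at hkj hkj' <;>
    simp [pointShift, lineShift] at hn <;> simp only [radius] at hr <;> simp only [radius, distance]
  -- In each case the number given to `between` is the index `a` of the required parity for which
  -- `d` falls between `r * cosMul m a` and `r * cosMul m (a + 2)`. In the cases with
  -- `cosMul_ne_of_lt` the line misses the circle of the points.
  · refine between 4 (by norm_num) (by norm_num) hr (by omega) ?_ ?_ <;> simp <;> field_simp <;>
      linarith
  · refine between 5 (by norm_num) (by norm_num) hr (by omega) ?_ ?_ <;> simp <;> field_simp <;>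
      linarith
  · refine between 3 (by norm_num) (by norm_num) hr (by omega) ?_ ?_ <;> simp <;> field_simp <;>
      linarith
  · refine between 3 (by norm_num) (by norm_num) hr (by omega) ?_ ?_ <;> simp <;> field_simp <;>
      linarith
  · refine cosMul_ne_of_lt hr ?_
    simp
    field_simp
    linarith
  · refine cosMul_ne_of_lt hr ?_
    simp
    field_simp
    linarith
  · refine between 2 (by norm_num) (by norm_num) hr (by omega) ?_ ?_ <;> simp <;> field_simp <;>
      linarith
  · refine cosMul_ne_of_lt hr ?_
    simp
    field_simp
    linarith
  · refine cosMul_ne_of_lt hr ?_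
    simp
    field_simp
    linarith
  · refine between 3 (by norm_num) (by norm_num) hr (by omega) ?_ ?_ <;> simp <;> field_simp <;>
      linarith
  · refine between 4 (by norm_num) (by norm_num) hr (by omega) ?_ ?_ <;> simp <;> field_simp <;>
      linarith
  · refine between 2 (by norm_num) (by norm_num) hr (by omega) ?_ ?_ <;> simp <;> field_simp <;>
      linarith
  · refine between 4 (by norm_num) (by norm_num) hr (by omega) ?_ ?_ <;> simp <;> field_simp <;>
      linarith
  · refine between 3 (by norm_num) (by norm_num) hr (by omega) ?_ ?_ <;> simp <;> field_simp <;>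
      linarith
  · refine between 4 (by norm_num) (by norm_num) hr (by omega) ?_ ?_ <;> simp <;> field_simp <;>
      linarith

/-! ### Coordinates of the points and lines

Class `some k` consists of the celestial points (lines) of class `k`, class `none` of the points
at infinity (the diameters). -/

/-- Homogeneous coordinates of the points. -/
def pointVec (m : ℕ) : Option (Fin 5) → ℤ → Fin 3 → ℝ
  | some k, b => ![-(radius m k * sin ((2 * b + pointShift k : ℤ) * (π / m))),
      radius m k * cos ((2 * b + pointShift k : ℤ) * (π / m)), 1]
  | none, b => ![cos ((2 * b : ℤ) * (π / m)), sin ((2 * b : ℤ) * (π / m)), 0]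

/-- Homogeneous coordinates of the lines. -/
def lineVec (m : ℕ) : Option (Fin 5) → ℤ → Fin 3 → ℝ
  | some j, a => ![-sin ((2 * a + lineShift j : ℤ) * (π / m)),
      cos ((2 * a + lineShift j : ℤ) * (π / m)), -distance m j]
  | none, a => ![cos ((2 * a : ℤ) * (π / m)), sin ((2 * a : ℤ) * (π / m)), 0]

/-- The points by class and index. -/
def pt (m : ℕ) (k : Option (Fin 5)) (b : ℤ) : Flat := Submodule.span ℝ {pointVec m k b}

/-- The lines by class and index. -/
def ln (m : ℕ) (j : Option (Fin 5)) (a : ℤ) : Flat := lineOf (lineVec m j a)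

theorem cos_sin_ne_zero {u : ℝ} (h : cos u = 0) (h' : sin u = 0) : False := by
  have := sin_sq_add_cos_sq u
  rw [h, h'] at this
  norm_num at this

theorem pointVec_ne_zero (m : ℕ) (k : Option (Fin 5)) (b : ℤ) : pointVec m k b ≠ 0 := by
  intro h
  cases k with
  | none => exact cos_sin_ne_zero (congrFun h 0) (congrFun h 1)
  | some k => simpa [pointVec] using congrFun h 2

theorem lineVec_ne_zero (m : ℕ) (j : Option (Fin 5)) (a : ℤ) : lineVec m j a ≠ 0 := by
  intro h
  cases j with
  | none => exact cos_sin_ne_zero (congrFun h 0) (congrFun h 1)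
  | some j => exact cos_sin_ne_zero (congrFun h 1) (by simpa [lineVec] using congrFun h 0)

theorem finrank_pt (m : ℕ) (k : Option (Fin 5)) (b : ℤ) : Module.finrank ℝ (pt m k b) = 1 :=
  finrank_span_singleton (pointVec_ne_zero m k b)

theorem finrank_ln (m : ℕ) (j : Option (Fin 5)) (a : ℤ) : Module.finrank ℝ (ln m j a) = 2 :=
  finrank_lineOf (lineVec_ne_zero m j a)

theorem angle_add_period {m : ℕ} (hm : m ≠ 0) (b c s : ℤ) :
    ((2 * (b + m * c) + s : ℤ) : ℝ) * (π / m) = (2 * b + s : ℤ) * (π / m) + c * (2 * π) := by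
  have : (m : ℝ) ≠ 0 := by exact_mod_cast hm
  push_cast
  field_simp
  ring

theorem pointVec_add_period {m : ℕ} (hm : m ≠ 0) (k : Option (Fin 5)) (b c : ℤ) :
    pointVec m k (b + m * c) = pointVec m k b := by
  cases k with
  | none =>
    have h := angle_add_period hm b c 0
    simp only [add_zero] at h
    simp only [pointVec, h, cos_add_int_mul_two_pi, sin_add_int_mul_two_pi]
  | some k =>
    simp only [pointVec, angle_add_period hm, cos_add_int_mul_two_pi, sin_add_int_mul_two_pi]

theorem lineVec_add_period {m : ℕ} (hm : m ≠ 0) (j : Option (Fin 5)) (a c : ℤ) :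
    lineVec m j (a + m * c) = lineVec m j a := by
  cases j with
  | none =>
    have h := angle_add_period hm a c 0
    simp only [add_zero] at h
    simp only [lineVec, h, cos_add_int_mul_two_pi, sin_add_int_mul_two_pi]
  | some j =>
    simp only [lineVec, angle_add_period hm, cos_add_int_mul_two_pi, sin_add_int_mul_two_pi]

theorem exists_add_period {m : ℕ} {b b' : ℤ} (h : (b : ZMod m) = b') : ∃ c, b' = b + m * c := by
  obtain ⟨c, hc⟩ := (ZMod.intCast_eq_intCast_iff_dvd_sub b b' m).1 h
  exact ⟨c, by linarith⟩

theorem pt_congr {m : ℕ} (hm : m ≠ 0) (k : Option (Fin 5)) (b b' : ℤ)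
    (h : (b : ZMod m) = b') : pt m k b = pt m k b' := by
  obtain ⟨c, rfl⟩ := exists_add_period h
  rw [pt, pt, pointVec_add_period hm]

theorem ln_congr {m : ℕ} (hm : m ≠ 0) (j : Option (Fin 5)) (a a' : ℤ)
    (h : (a : ZMod m) = a') : ln m j a = ln m j a' := by
  obtain ⟨c, rfl⟩ := exists_add_period h
  rw [ln, ln, lineVec_add_period hm]

/-! ### Incidence -/

/-- The voltage table: a point of class `k` and index `b` lies on the line of class `j` and index
`a` if and only if `b - a` belongs to the entry `k`, `j`. Modulo `2 * ℓ + 1`, the number `ℓ + 1`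
is one half. -/
def voltage (ℓ : ℕ) : Option (Fin 5) → Option (Fin 5) → Finset (ZMod (2 * ℓ + 1))
  | some k, some j =>
    if k = j then {0, (spanS j : ZMod (2 * ℓ + 1))}
    else if k = j + 1 then {0, (spanT j : ZMod (2 * ℓ + 1))} else ∅
  | none, some j => {(lineShift j : ZMod (2 * ℓ + 1)) * (ℓ + 1)}
  | some k, none => {-(pointShift k : ZMod (2 * ℓ + 1)) * (ℓ + 1)}
  | none, none => ∅

theorem two_mul_half (ℓ : ℕ) : (2 : ZMod (2 * ℓ + 1)) * (ℓ + 1) = 1 := by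
  have : ((2 * ℓ + 1 : ℕ) : ZMod (2 * ℓ + 1)) = 0 := ZMod.natCast_self _
  push_cast at this
  linear_combination this

theorem dvd_iff_eq_half (ℓ : ℕ) (n s : ℤ) :
    ((2 * ℓ + 1 : ℕ) : ℤ) ∣ 2 * n - s ↔ (n : ZMod (2 * ℓ + 1)) = s * (ℓ + 1) := by
  rw [← ZMod.intCast_zmod_eq_zero_iff_dvd]
  push_cast
  have h := two_mul_half ℓ
  constructor
  · intro e
    linear_combination (ℓ + 1 : ZMod (2 * ℓ + 1)) * e - (n : ZMod (2 * ℓ + 1)) * h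
  · intro e
    linear_combination 2 * e + (s : ZMod (2 * ℓ + 1)) * h

theorem dvd_iff_eq_of_even {m : ℕ} (n s : ℤ) :
    (2 * m : ℤ) ∣ 2 * n - s - s ↔ (n : ZMod m) = s := by
  rw [show 2 * n - s - s = 2 * (n - s) by ring, Int.mul_dvd_mul_iff_left two_ne_zero, eq_comm,
    ← ZMod.intCast_eq_intCast_iff_dvd_sub]

/-- The two signs in the equality of cosines give the two points of a class on a line. -/
theorem radius_mul_cosMul_eq_iff {m : ℕ} (hm : m ≠ 0) {r d : ℝ} (hr : 0 < r) (n s : ℤ)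
    (hd : r * cosMul m s = d) :
    r * cosMul m (2 * n - s) = d ↔ (n : ZMod m) ∈ ({0, (s : ZMod m)} : Finset (ZMod m)) := by
  rw [← hd, mul_right_inj' hr.ne', cosMul_eq_iff hm, dvd_iff_eq_of_even, sub_add_cancel,
    Int.mul_dvd_mul_iff_left two_ne_zero, ← ZMod.intCast_zmod_eq_zero_iff_dvd, Finset.mem_insert,
    Finset.mem_singleton, or_comm]

theorem pointShift_sub (j : Fin 5) : pointShift j - lineShift j = -spanS j := by
  fin_cases j <;> rfl

theorem pointShift_succ_sub (j : Fin 5) : pointShift (j + 1) - lineShift j = -spanT j := by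
  fin_cases j <;> rfl

/-- The dot product of the coordinate vectors is an addition formula: a sine when exactly one class
is `none`, a cosine otherwise. -/
theorem pt_le_ln_iff {ℓ : ℕ} (hℓ : 5 ≤ ℓ) (k j : Option (Fin 5)) (b a : ℤ) :
    pt (2 * ℓ + 1) k b ≤ ln (2 * ℓ + 1) j a ↔
      (b : ZMod (2 * ℓ + 1)) - a ∈ voltage ℓ k j := by
  have hm : 2 * ℓ + 1 ≠ 0 := by omega
  have hm' : 11 ≤ 2 * ℓ + 1 := by omega
  rw [pt, ln, span_le_lineOf, ← Int.cast_sub]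
  cases k with
  | none =>
    cases j with
    | none =>
      simp only [pointVec, lineVec, voltage, Finset.notMem_empty, iff_false]
      intro h
      have h1 : cosMul (2 * ℓ + 1) (2 * (b - a)) = 0 := by
        rw [cosMul, show 2 * (b - a) = 2 * b - 2 * a by ring, Int.cast_sub, sub_mul, cos_sub]
        simp at h ⊢
        linarith
      rw [cosMul, cos_eq_zero_iff] at h1
      obtain ⟨q, hq⟩ := h1
      have h2 : ((2 * ℓ + 1 : ℕ) : ℝ) ≠ 0 := by exact_mod_cast hm
      rw [mul_div_assoc', div_eq_iff h2] at hq
      have h3 : ((2 * (2 * (b - a)) : ℤ) : ℝ) = ((2 * q + 1) * (2 * ℓ + 1) : ℤ) := by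
        apply mul_right_cancel₀ pi_ne_zero
        push_cast at hq ⊢
        linear_combination 2 * hq
      have h4 : 2 * (2 * (b - a)) = (2 * q + 1) * (2 * ℓ + 1) := by exact_mod_cast h3
      -- As `m` is odd, no direction `2bπ/m` is perpendicular to a normal `2aπ/m`: an even number
      -- would be odd.
      have h5 : 2 * (2 * (b - a)) = 2 * (2 * q * ℓ + q + ℓ) + 1 := by linarith
      omega
    | some j =>
      rw [voltage, Finset.mem_singleton, ← dvd_iff_eq_half, ← sin_mul_eq_zero_iff hm,
        show 2 * (b - a) - lineShift j = 2 * b - (2 * a + lineShift j) by ring, Int.cast_sub,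
        sub_mul, sin_sub]
      simp only [pointVec, lineVec]
      simp
      constructor <;> intro h <;> linarith
  | some k =>
    have hr := radius_pos hm' k
    cases j with
    | none =>
      rw [voltage, Finset.mem_singleton, ← Int.cast_neg, ← dvd_iff_eq_half,
        ← sin_mul_eq_zero_iff hm,
        show 2 * (b - a) - -pointShift k = (2 * b + pointShift k) - 2 * a by ring, Int.cast_sub,
        sub_mul, sin_sub]
      simp only [pointVec, lineVec]
      simp only [Matrix.cons_val_zero, Matrix.cons_val_one, Matrix.cons_val]
      constructor
      · intro h
        exact mul_left_cancel₀ hr.ne' (by linarith)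
      · intro h
        linear_combination -(radius (2 * ℓ + 1) k) * h
    | some j =>
      have e : (lineVec (2 * ℓ + 1) (some j) a 0 * pointVec (2 * ℓ + 1) (some k) b 0 +
          lineVec (2 * ℓ + 1) (some j) a 1 * pointVec (2 * ℓ + 1) (some k) b 1 +
          lineVec (2 * ℓ + 1) (some j) a 2 * pointVec (2 * ℓ + 1) (some k) b 2 = 0) ↔
          radius (2 * ℓ + 1) k * cosMul (2 * ℓ + 1) (2 * (b - a) + (pointShift k - lineShift j))
            = distance (2 * ℓ + 1) j := by
        rw [cosMul, show 2 * (b - a) + (pointShift k - lineShift j)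
          = (2 * b + pointShift k) - (2 * a + lineShift j) by ring, Int.cast_sub, sub_mul, cos_sub]
        simp only [pointVec, lineVec]
        simp only [Matrix.cons_val_zero, Matrix.cons_val_one, Matrix.cons_val]
        constructor <;> intro h <;> linarith
      rw [e]
      simp only [voltage]
      split_ifs with h1 h2
      · subst h1
        rw [pointShift_sub, ← sub_eq_add_neg]
        exact radius_mul_cosMul_eq_iff hm hr _ _ (radius_mul_spanS hm' k)
      · subst h2
        rw [pointShift_succ_sub, ← sub_eq_add_neg]
        exact radius_mul_cosMul_eq_iff hm hr _ _ (radius_mul_spanT hm' j)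
      · simp only [Finset.notMem_empty, iff_false]
        exact radius_mul_cosMul_ne hm' h1 h2 ⟨b - a, by ring⟩

/-! ### Combinatorics of the voltage table -/

theorem intCast_ne_zero {ℓ : ℕ} (hℓ : 5 ≤ ℓ) {n : ℤ} (h0 : 0 < n) (h : n ≤ 10) :
    (n : ZMod (2 * ℓ + 1)) ≠ 0 := by
  rw [Ne, ZMod.intCast_zmod_eq_zero_iff_dvd]
  intro h1
  have := Int.le_of_dvd h0 h1
  push_cast at this
  omega

/-- The values on the right no longer involve `ℓ`, so that all statements on sums and supports
become finite checks for `decide`. -/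
theorem card_voltage {ℓ : ℕ} (hℓ : 5 ≤ ℓ) (k j : Option (Fin 5)) :
    (voltage ℓ k j).card = match k, j with
      | some k, some j => if k = j ∨ k = j + 1 then 2 else 0
      | none, none => 0
      | _, _ => 1 := by
  have hs : ∀ j, (0 : ZMod (2 * ℓ + 1)) ≠ spanS j := fun j =>
    (intCast_ne_zero hℓ (by fin_cases j <;> simp [spanS]) (by fin_cases j <;> simp [spanS])).symm
  have ht : ∀ j, (0 : ZMod (2 * ℓ + 1)) ≠ spanT j := fun j =>
    (intCast_ne_zero hℓ (by fin_cases j <;> simp [spanT]) (by fin_cases j <;> simp [spanT])).symm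
  cases k with
  | none => cases j <;> simp [voltage]
  | some k =>
    cases j with
    | none => simp [voltage]
    | some j =>
      simp only [voltage]
      split_ifs with h1 h2 h3 h4 h5 <;>
        first
        | exact Finset.card_pair (hs _)
        | exact Finset.card_pair (ht _)
        | simp_all

/-- Distinctness comes from incidences alone: the rows have different supports, and each has an
entry with one voltage, which fixes the index. For celestial points that entry belongs to the
diameters. -/
theorem pt_eq_iff {ℓ : ℕ} (hℓ : 5 ≤ ℓ) (k k' : Option (Fin 5)) (b b' : ℤ) :
    pt (2 * ℓ + 1) k b = pt (2 * ℓ + 1) k' b' ↔ k = k' ∧ (b : ZMod (2 * ℓ + 1)) = b' := by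
  refine point_eq_iff (inc := (· ≤ ·)) (pt_congr (by omega)) (pt_le_ln_iff hℓ) ?_ ?_ k k' b b'
  · simp only [← Finset.card_pos, card_voltage hℓ]
    decide
  · simp only [card_voltage hℓ]
    decide

theorem ln_eq_iff {ℓ : ℕ} (hℓ : 5 ≤ ℓ) (j j' : Option (Fin 5)) (a a' : ℤ) :
    ln (2 * ℓ + 1) j a = ln (2 * ℓ + 1) j' a' ↔ j = j' ∧ (a : ZMod (2 * ℓ + 1)) = a' := by
  refine point_eq_iff (inc := fun x y => y ≤ x)
    (E := fun j k => (voltage ℓ k j).map (Equiv.neg (ZMod (2 * ℓ + 1))).toEmbedding)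
    (ln_congr (by omega)) (l := pt (2 * ℓ + 1)) ?_ ?_ ?_ j j' a a'
  · intro j k a b
    rw [pt_le_ln_iff hℓ, Finset.mem_map_equiv]
    simp
  · simp only [← Finset.card_pos, Finset.card_map, card_voltage hℓ]
    decide
  · simp only [Finset.card_map, card_voltage hℓ]
    decide

/-! ### The celestial configuration -/

theorem vertex_eq_pt {m : ℕ} (i : ℤ) : vertex m i = pt m (some 0) i := by
  have h : π / 2 + 2 * π * i / m = (2 * i + pointShift 0 : ℤ) * (π / m) + π / 2 := by
    simp only [pointShift]
    push_cast
    simp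
    ring
  rw [vertex, ordinaryPoint, pt, pointVec, h, cos_add_pi_div_two, sin_add_pi_div_two]
  simp [radius]

theorem symbolD5_getD {j : ℕ} (hj : j < 5) :
    symbolD5.getD j (0, 0) = (spanS (Fin.ofNat 5 j), spanT (Fin.ofNat 5 j)) := by
  interval_cases j <;> rfl

theorem ofNat_succ {j : ℕ} (hj : j < 5) : Fin.ofNat 5 (j + 1) = Fin.ofNat 5 j + 1 := by
  interval_cases j <;> rfl

theorem pt_sup_pt {ℓ : ℕ} (hℓ : 5 ≤ ℓ) (j : Fin 5) (i : ℤ) :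
    pt (2 * ℓ + 1) (some j) i ⊔ pt (2 * ℓ + 1) (some j) (i + spanS j)
      = ln (2 * ℓ + 1) (some j) i := by
  refine sup_eq_of_finrank (finrank_pt _ _ _) (finrank_pt _ _ _) (finrank_ln _ _ _) ?_ ?_ ?_
  · rw [Ne, pt_eq_iff hℓ]
    push_cast
    have := intCast_ne_zero hℓ (n := spanS j) (by fin_cases j <;> simp [spanS])
      (by fin_cases j <;> simp [spanS])
    simpa using this
  · simp [pt_le_ln_iff hℓ, voltage]
  · simp [pt_le_ln_iff hℓ, voltage]

theorem ln_inf_ln {ℓ : ℕ} (hℓ : 5 ≤ ℓ) (j : Fin 5) (i : ℤ) :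
    ln (2 * ℓ + 1) (some j) i ⊓ ln (2 * ℓ + 1) (some j) (i - spanT j)
      = pt (2 * ℓ + 1) (some (j + 1)) i := by
  refine inf_eq_of_finrank (finrank_pt _ _ _) (finrank_ln _ _ _) (finrank_ln _ _ _) ?_ ?_ ?_
  · rw [Ne, ln_eq_iff hℓ]
    push_cast
    have := intCast_ne_zero hℓ (n := spanT j) (by fin_cases j <;> simp [spanT])
      (by fin_cases j <;> simp [spanT])
    simpa [eq_comm (b := (i : ZMod (2 * ℓ + 1)) - _), sub_eq_self] using this
  · simp [pt_le_ln_iff hℓ, voltage]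
  · simp [pt_le_ln_iff hℓ, voltage]

/-- Joins and meets are recognised by their incidences, so no intersection is computed. The bound
includes `j = 5`, where the class wraps to 0; this is the closing of the construction. -/
theorem celestialPoint_eq_pt {ℓ : ℕ} (hℓ : 5 ≤ ℓ) {j : ℕ} (hj : j ≤ 5) (i : ℤ) :
    celestialPoint (2 * ℓ + 1) symbolD5 j i = pt (2 * ℓ + 1) (some (Fin.ofNat 5 j)) i := by
  induction j generalizing i with
  | zero => rw [celestialPoint, vertex_eq_pt]; rfl
  | succ j ih =>
    simp only [celestialPoint, symbolD5_getD (show j < 5 by omega), ih (by omega), pt_sup_pt hℓ]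
    rw [ln_inf_ln hℓ, ofNat_succ (by omega)]

theorem celestialLine_eq_ln {ℓ : ℕ} (hℓ : 5 ≤ ℓ) {j : ℕ} (hj : j < 5) (i : ℤ) :
    celestialLine (2 * ℓ + 1) symbolD5 j i = ln (2 * ℓ + 1) (some (Fin.ofNat 5 j)) i := by
  simp only [celestialLine, symbolD5_getD hj, celestialPoint_eq_pt hℓ hj.le, pt_sup_pt hℓ]

theorem celestialPoints_eq {ℓ : ℕ} (hℓ : 5 ≤ ℓ) :
    celestialPoints (2 * ℓ + 1) symbolD5
      = {q | ∃ (k : Fin 5) (b : ℤ), q = pt (2 * ℓ + 1) (some k) b} := by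
  ext q
  constructor
  · rintro ⟨j, hj, i, rfl⟩
    exact ⟨Fin.ofNat 5 j, i, celestialPoint_eq_pt hℓ (Nat.le_of_lt hj) i⟩
  · rintro ⟨k, i, rfl⟩
    exact ⟨k, k.2, i, by rw [celestialPoint_eq_pt hℓ k.2.le, Fin.ofNat_val_eq_self]⟩

theorem celestialLines_eq {ℓ : ℕ} (hℓ : 5 ≤ ℓ) :
    celestialLines (2 * ℓ + 1) symbolD5
      = {q | ∃ (k : Fin 5) (b : ℤ), q = ln (2 * ℓ + 1) (some k) b} := by
  ext q
  constructor
  · rintro ⟨j, hj, i, rfl⟩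
    exact ⟨Fin.ofNat 5 j, i, celestialLine_eq_ln hℓ hj i⟩
  · rintro ⟨k, i, rfl⟩
    exact ⟨k, k.2, i, by rw [celestialLine_eq_ln hℓ k.2, Fin.ofNat_val_eq_self]⟩

theorem map_rotation_pt (m : ℕ) (k : Fin 5) (i : ℤ) :
    (pt m (some k) i).map (rotation (2 * π / m)) = pt m (some k) (i + 1) := by
  rw [pt, pt, Submodule.map_span, Set.image_singleton]
  congr 2
  have h : ((2 * (i + 1) + pointShift k : ℤ) : ℝ) * (π / m)
      = 2 * π / m + (2 * i + pointShift k : ℤ) * (π / m) := by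
    push_cast
    ring
  ext c
  simp only [pointVec, h, cos_add, sin_add, rotation, Matrix.toLin'_apply]
  fin_cases c <;> simp [Matrix.mulVec, dotProduct, Fin.sum_univ_three] <;> ring

theorem not_pt_le_lineAtInfinity (m : ℕ) (k : Fin 5) (b : ℤ) :
    ¬ pt m (some k) b ≤ lineAtInfinity := by
  rw [pt, Submodule.span_singleton_le_iff_mem]
  simp [lineAtInfinity, pointVec]

theorem isCelestial_symbolD5 {ℓ : ℕ} (hℓ : 5 ≤ ℓ) : IsCelestial (2 * ℓ + 1) symbolD5 where
  config := by
    rw [celestialPoints_eq hℓ, celestialLines_eq hℓ]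
    refine ⟨?_, ?_, ?_⟩
    · rintro _ ⟨k, b, rfl⟩
      exact finrank_pt _ _ _
    · rintro _ ⟨k, b, rfl⟩
      exact finrank_ln _ _ _
    · rw [show (2 * ℓ + 1) * symbolD5.length = Fintype.card (Fin 5) * (2 * ℓ + 1) by
        rw [Fintype.card_fin, mul_comm]; rfl]
      refine isConfiguration_of_cyclic (fun k k' b b' => ?_) (fun k k' b b' => ?_)
        (fun k j b a => pt_le_ln_iff hℓ (some k) (some j) b a) ?_ ?_
      · simp [pt_eq_iff hℓ]
      · simp [ln_eq_iff hℓ]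
      · simp only [card_voltage hℓ]
        decide
      · simp only [card_voltage hℓ]
        decide
  ordinary := by
    rw [celestialPoints_eq hℓ]
    rintro _ ⟨k, b, rfl⟩
    exact not_pt_le_lineAtInfinity _ _ _
  rotate_point := by
    intro j hj i
    rw [celestialPoint_eq_pt hℓ (Nat.le_of_lt hj), celestialPoint_eq_pt hℓ (Nat.le_of_lt hj)]
    exact map_rotation_pt _ _ _
  rotate_line := by
    intro j hj i
    rw [celestialLine_eq_ln hℓ hj, celestialLine_eq_ln hℓ hj, ← pt_sup_pt hℓ, ← pt_sup_pt hℓ,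
      Submodule.map_sup, map_rotation_pt, map_rotation_pt, add_right_comm]
  incidence := by
    intro j hj i
    have hj' : j < 5 := hj
    rw [celestialLine_eq_ln hℓ hj', celestialPoint_eq_pt hℓ hj'.le,
      celestialPoint_eq_pt hℓ hj'.le, celestialPoint_eq_pt hℓ hj', celestialPoint_eq_pt hℓ hj',
      symbolD5_getD hj', ofNat_succ hj']
    simp [pt_le_ln_iff hℓ, voltage]
  closing := by
    refine ⟨0, by simp [symbolD5], fun i => ?_⟩
    rw [show symbolD5.length = 5 from rfl, celestialPoint_eq_pt hℓ le_rfl,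
      celestialPoint_eq_pt hℓ (by norm_num), add_zero]
    rfl

/-! ### The extended configuration -/

theorem diameter_eq_ln (m : ℕ) (i : ℤ) : diameter m i = ln m none i := by
  rw [diameter, vertex_eq_pt]
  refine sup_eq_of_finrank (finrank_pt _ _ _) ?_ (finrank_ln _ _ _) ?_ ?_ ?_
  · refine finrank_span_singleton fun h => ?_
    simpa using congrFun h 2
  · intro h
    have h1 : pointVec m (some 0) i ∈ ordinaryPoint 0 0 := by
      rw [← h]
      exact Submodule.mem_span_singleton_self _
    obtain ⟨c, hc⟩ := Submodule.mem_span_singleton.1 h1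
    refine cos_sin_ne_zero (u := (2 * i + pointShift 0 : ℤ) * (π / m)) ?_ ?_
    · simpa [pointVec, radius] using (congrFun hc 1).symm
    · simpa [pointVec, radius] using (congrFun hc 0).symm
  · rw [pt, ln, span_le_lineOf]
    simp [pointVec, lineVec, radius, pointShift]
    ring
  · rw [ordinaryPoint, ln, span_le_lineOf]
    simp [lineVec]

theorem pointAtInfinity_eq_pt (ℓ : ℕ) (i : ℤ) :
    pointAtInfinity (2 * i * π / (2 * ℓ + 1)) = pt (2 * ℓ + 1) none i := by
  have h : 2 * (i : ℝ) * π / (2 * ℓ + 1) = (2 * i : ℤ) * (π / (2 * ℓ + 1 : ℕ)) := by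
    push_cast
    ring
  rw [pointAtInfinity, h, pt, pointVec]

theorem D5Points_eq {ℓ : ℕ} (hℓ : 5 ≤ ℓ) :
    D5Points ℓ = {q | ∃ (k : Option (Fin 5)) (b : ℤ), q = pt (2 * ℓ + 1) k b} := by
  ext q
  simp only [D5Points, celestialPoints_eq hℓ, pointAtInfinity_eq_pt, Set.mem_union,
    Set.mem_ofPred_eq, Option.exists, or_comm]

theorem D5Lines_eq {ℓ : ℕ} (hℓ : 5 ≤ ℓ) :
    D5Lines ℓ = {q | ∃ (k : Option (Fin 5)) (b : ℤ), q = ln (2 * ℓ + 1) k b} := by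
  ext q
  simp only [D5Lines, celestialLines_eq hℓ, diameter_eq_ln, Set.mem_union,
    Set.mem_ofPred_eq, Option.exists, or_comm]

theorem isExtendedConfiguration_D5 {ℓ : ℕ} (hℓ : 5 ≤ ℓ) :
    IsExtendedConfiguration (12 * ℓ + 6) 5 (D5Points ℓ) (D5Lines ℓ) := by
  rw [D5Points_eq hℓ, D5Lines_eq hℓ]
  refine ⟨?_, ?_, ?_⟩
  · rintro _ ⟨k, b, rfl⟩
    exact finrank_pt _ _ _
  · rintro _ ⟨k, b, rfl⟩
    exact finrank_ln _ _ _
  · rw [show 12 * ℓ + 6 = Fintype.card (Option (Fin 5)) * (2 * ℓ + 1) by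
      rw [Fintype.card_option, Fintype.card_fin]; ring]
    refine isConfiguration_of_cyclic (pt_eq_iff hℓ) (ln_eq_iff hℓ) (pt_le_ln_iff hℓ) ?_ ?_
    · simp only [card_voltage hℓ]
      decide
    · simp only [card_voltage hℓ]
      decide

/-! ### Projective images in the Euclidean plane -/

/-- The point map runs backwards, since the image points are given as a preimage under `pullback`,
while lines are pushed forward. -/
theorem IsConfiguration.transfer {P P' L L' : Type*} {inc : P → L → Prop} {inc' : P' → L' → Prop}
    {n k : ℕ} {pts : Set P} {lns : Set L} (h : IsConfiguration inc n k pts lns)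
    {φ : P' → P} {ψ : L → L'} (hφ : Function.Injective φ) (hrange : pts ⊆ Set.range φ)
    (hψ : Set.InjOn ψ lns) (hinc : ∀ p l, inc' p (ψ l) ↔ inc (φ p) l) :
    IsConfiguration inc' n k (φ ⁻¹' pts) (ψ '' lns) := by
  obtain ⟨h1, h2, h3, h4, h5, h6⟩ := h
  refine ⟨h1.preimage hφ.injOn, h2.image ψ, ?_, ?_, ?_, ?_⟩
  · rw [Set.ncard_preimage_of_injective_subset_range hφ hrange, h3]
  · rw [Set.InjOn.ncard_image hψ, h4]
  · rintro _ ⟨l, hl, rfl⟩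
    have : {p ∈ φ ⁻¹' pts | inc' p (ψ l)} = φ ⁻¹' {p ∈ pts | inc p l} := by
      ext p
      simp [hinc]
    rw [this, Set.ncard_preimage_of_injective_subset_range hφ
      (fun p hp => hrange hp.1), h5 l hl]
  · intro p hp
    have : {l ∈ ψ '' lns | inc' p l} = ψ '' {l ∈ lns | inc (φ p) l} := by
      ext l
      constructor
      · rintro ⟨⟨l, hl, rfl⟩, h⟩
        exact ⟨l, ⟨hl, (hinc p l).1 h⟩, rfl⟩
      · rintro ⟨l, ⟨hl, h⟩, rfl⟩
        exact ⟨⟨l, hl, rfl⟩, (hinc p l).2 h⟩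
    rw [this, Set.InjOn.ncard_image (hψ.mono fun l hl => hl.1), h6 _ hp]

theorem ordinaryPoint_le_iff (x : E2) (W : Flat) :
    ordinaryPoint (x 0) (x 1) ≤ W ↔ x ∈ affineLine W :=
  Submodule.span_singleton_le_iff_mem _ _

theorem finrank_ordinaryPoint (x y : ℝ) : Module.finrank ℝ (ordinaryPoint x y) = 1 :=
  finrank_span_singleton fun h => by simpa using congrFun h 2

theorem ordinaryPoint_injective :
    Function.Injective fun x : E2 => ordinaryPoint (x 0) (x 1) := by
  intro x y h
  have h1 : ![x 0, x 1, 1] ∈ ordinaryPoint (y 0) (y 1) := by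
    rw [← show ordinaryPoint (x 0) (x 1) = ordinaryPoint (y 0) (y 1) from h]
    exact Submodule.mem_span_singleton_self _
  obtain ⟨c, hc⟩ := Submodule.mem_span_singleton.1 h1
  have h2 : c = 1 := by simpa using congrFun hc 2
  subst h2
  ext i
  fin_cases i
  · simpa using (congrFun hc 0).symm
  · simpa using (congrFun hc 1).symm

theorem exists_ordinaryPoint_le {W : Flat} (h : ¬ W ≤ lineAtInfinity) :
    ∃ x : E2, ordinaryPoint (x 0) (x 1) ≤ W := by
  obtain ⟨v, hv, hv'⟩ := SetLike.not_le_iff_exists.1 h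
  have hv2 : v 2 ≠ 0 := by simpa [lineAtInfinity] using hv'
  refine ⟨!₂[(v 2)⁻¹ * v 0, (v 2)⁻¹ * v 1], ?_⟩
  rw [ordinaryPoint, Submodule.span_singleton_le_iff_mem]
  convert W.smul_mem (v 2)⁻¹ hv using 1
  ext i
  fin_cases i <;> simp [hv2]

theorem exists_ordinaryPoint_eq {p : Flat} (hp : Module.finrank ℝ p = 1)
    (h : ¬ p ≤ lineAtInfinity) : ∃ x : E2, ordinaryPoint (x 0) (x 1) = p := by
  obtain ⟨x, hx⟩ := exists_ordinaryPoint_le h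
  exact ⟨x, Submodule.eq_of_le_of_finrank_le hx (by rw [hp, finrank_ordinaryPoint])⟩

theorem affineLine_sup (x y : E2) :
    affineLine (ordinaryPoint (x 0) (x 1) ⊔ ordinaryPoint (y 0) (y 1)) = line[ℝ, x, y] := by
  ext z
  rw [← ordinaryPoint_le_iff, ordinaryPoint, ordinaryPoint, ordinaryPoint,
    Submodule.span_singleton_le_iff_mem, ← Submodule.span_union, Set.singleton_union,
    Submodule.mem_span_pair, mem_affineSpan_pair_iff_exists_lineMap_eq]
  constructor
  · rintro ⟨a, b, h⟩
    have h0 := congrFun h 0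
    have h1 := congrFun h 1
    have h2 := congrFun h 2
    simp at h0 h1 h2
    refine ⟨b, ?_⟩
    obtain rfl : a = 1 - b := by linarith
    ext i
    fin_cases i <;> simp [AffineMap.lineMap_apply] <;> linarith
  · rintro ⟨r, rfl⟩
    refine ⟨1 - r, r, ?_⟩
    ext i
    fin_cases i <;> simp [AffineMap.lineMap_apply] <;> ring

section ProjImage

variable {f : (Fin 3 → ℝ) ≃ₗ[ℝ] (Fin 3 → ℝ)} {n k : ℕ} {S T : Set Flat}

/-- The point of the extended plane that is moved to the given point of the Euclidean plane. -/
def pullback (f : (Fin 3 → ℝ) ≃ₗ[ℝ] (Fin 3 → ℝ)) (x : E2) : Flat :=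
  (ordinaryPoint (x 0) (x 1)).map (f.symm : (Fin 3 → ℝ) →ₗ[ℝ] (Fin 3 → ℝ))

/-- The image of a line of the extended plane, as a line of the Euclidean plane. -/
def pushLine (f : (Fin 3 → ℝ) ≃ₗ[ℝ] (Fin 3 → ℝ)) (W : Flat) : AffineSubspace ℝ E2 :=
  affineLine (W.map (f : (Fin 3 → ℝ) →ₗ[ℝ] (Fin 3 → ℝ)))

theorem map_symm_map (f : (Fin 3 → ℝ) ≃ₗ[ℝ] (Fin 3 → ℝ)) (W : Flat) :
    (W.map (f : (Fin 3 → ℝ) →ₗ[ℝ] (Fin 3 → ℝ))).map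
      (f.symm : (Fin 3 → ℝ) →ₗ[ℝ] (Fin 3 → ℝ)) = W := by
  rw [← Submodule.map_comp]
  simp

theorem map_map_symm (f : (Fin 3 → ℝ) ≃ₗ[ℝ] (Fin 3 → ℝ)) (W : Flat) :
    (W.map (f.symm : (Fin 3 → ℝ) →ₗ[ℝ] (Fin 3 → ℝ))).map
      (f : (Fin 3 → ℝ) →ₗ[ℝ] (Fin 3 → ℝ)) = W := by
  rw [← Submodule.map_comp]
  simp

theorem mem_pushLine (x : E2) (W : Flat) : x ∈ pushLine f W ↔ pullback f x ≤ W := by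
  rw [pushLine, ← ordinaryPoint_le_iff, pullback]
  constructor
  · intro h
    have := Submodule.map_mono (f := (f.symm : (Fin 3 → ℝ) →ₗ[ℝ] (Fin 3 → ℝ))) h
    rwa [map_symm_map] at this
  · intro h
    have := Submodule.map_mono (f := (f : (Fin 3 → ℝ) →ₗ[ℝ] (Fin 3 → ℝ))) h
    rwa [map_map_symm] at this

theorem pullback_injective : Function.Injective (pullback f) := by
  intro x y h
  have := congrArg (fun W => W.map (f : (Fin 3 → ℝ) →ₗ[ℝ] (Fin 3 → ℝ))) h
  simp only [pullback, map_map_symm] at this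
  exact ordinaryPoint_injective this

theorem affinePoints_projImage : affinePoints (projImage f S) = pullback f ⁻¹' S := by
  ext x
  constructor
  · rintro ⟨W, hW, h⟩
    simp only [Set.mem_preimage, pullback, ← h, map_symm_map, hW]
  · intro h
    exact ⟨_, h, map_map_symm _ _⟩

theorem affineLines_projImage : affineLines (projImage f T) = pushLine f '' T := by
  rw [affineLines, projImage, Set.image_image]
  rfl

theorem exists_pullback_eq (hf : ProjectsIntoPlane f S) (hS : ∀ p ∈ S, Module.finrank ℝ p = 1)
    {p : Flat} (hp : p ∈ S) : ∃ x, pullback f x = p := by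
  obtain ⟨x, hx⟩ := exists_ordinaryPoint_eq
    (p := p.map (f : (Fin 3 → ℝ) →ₗ[ℝ] (Fin 3 → ℝ)))
    (by rw [LinearEquiv.finrank_map_eq, hS p hp]) (hf _ ⟨p, hp, rfl⟩)
  exact ⟨x, by rw [pullback, hx, map_symm_map]⟩

/-- Every line of the configuration joins two of its points. -/
theorem exists_eq_sup (h : IsExtendedConfiguration n k S T) (hk : 2 ≤ k)
    (hf : ProjectsIntoPlane f S) {W : Flat} (hW : W ∈ T) :
    ∃ x y, x ≠ y ∧ pullback f x ⊔ pullback f y = W := by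
  obtain ⟨h1, h2, -, -, -, -, h3, -⟩ := h
  have h4 : {p ∈ S | p ≤ W}.ncard = k := h3 W hW
  have h5 : {p ∈ S | p ≤ W}.Finite := Set.finite_of_ncard_pos (by omega)
  obtain ⟨p, q, hp, hq, hpq⟩ := (Set.one_lt_ncard_iff h5).1 (by omega)
  obtain ⟨x, rfl⟩ := exists_pullback_eq hf h1 hp.1
  obtain ⟨y, rfl⟩ := exists_pullback_eq hf h1 hq.1
  exact ⟨x, y, fun e => hpq (by rw [e]),
    sup_eq_of_finrank (h1 _ hp.1) (h1 _ hq.1) (h2 W hW) hpq hp.2 hq.2⟩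

/-- A line is recovered from two configuration points on it, whose images are finite. -/
theorem injOn_pushLine (h : IsExtendedConfiguration n k S T) (hk : 2 ≤ k)
    (hf : ProjectsIntoPlane f S) : Set.InjOn (pushLine f) T := by
  have key : ∀ W ∈ T, ∀ W', pushLine f W = pushLine f W' → W ≤ W' := by
    intro W hW W' e
    obtain ⟨x, y, -, rfl⟩ := exists_eq_sup h hk hf hW
    refine sup_le ?_ ?_
    · rw [← mem_pushLine, ← e, mem_pushLine]
      exact le_sup_left
    · rw [← mem_pushLine, ← e, mem_pushLine]
      exact le_sup_right
  exact fun W hW W' hW' e => le_antisymm (key W hW W' e) (key W' hW' W e.symm)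

theorem pushLine_sup (x y : E2) :
    pushLine f (pullback f x ⊔ pullback f y) = line[ℝ, x, y] := by
  rw [pushLine, Submodule.map_sup, pullback, pullback, map_map_symm, map_map_symm, affineLine_sup]

theorem isGeometricConfiguration_projImage (h : IsExtendedConfiguration n k S T) (hk : 2 ≤ k)
    (hf : ProjectsIntoPlane f S) :
    IsGeometricConfiguration n k (affinePoints (projImage f S))
      (affineLines (projImage f T)) := by
  rw [affinePoints_projImage, affineLines_projImage]
  refine ⟨?_, h.2.2.transfer pullback_injective (fun p hp => exists_pullback_eq hf h.1 hp)
    (injOn_pushLine h hk hf) mem_pushLine⟩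
  rintro _ ⟨W, hW, rfl⟩
  obtain ⟨x, y, hxy, rfl⟩ := exists_eq_sup h hk hf hW
  rw [pushLine_sup]
  refine ⟨⟨x, left_mem_affineSpan_pair ℝ x y⟩, ?_⟩
  rw [direction_affineSpan, vectorSpan_pair]
  exact finrank_span_singleton (vsub_ne_zero.2 hxy)

/-- Two image lines whose preimages meet in a point that is not moved to infinity coincide if they
are parallel. -/
theorem pushLine_eq_of_parallel {W W' : Flat}
    (h : ¬ (W ⊓ W').map (f : (Fin 3 → ℝ) →ₗ[ℝ] (Fin 3 → ℝ)) ≤ lineAtInfinity)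
    (hp : (pushLine f W).Parallel (pushLine f W')) : pushLine f W = pushLine f W' := by
  obtain ⟨x, hx⟩ := exists_ordinaryPoint_le h
  rw [ordinaryPoint_le_iff] at hx
  have hx' : x ∈ pushLine f (W ⊓ W') := hx
  rw [mem_pushLine] at hx'
  exact AffineSubspace.ext_of_direction_eq hp.direction_eq
    ⟨x, (mem_pushLine x W).2 (hx'.trans inf_le_left), (mem_pushLine x W').2 (hx'.trans inf_le_right)⟩

/-- A line and two others that meet it in different points outside the configuration provide
independent pencils in every projective image in the Euclidean plane. -/
theorem hasIndependentPencils_projImage (h : IsExtendedConfiguration n k S T) (hk : 2 ≤ k)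
    (hf : ProjectsIntoPlane f S) {W D D' : Flat} (hW : W ∈ T) (hD : D ∈ T) (hD' : D' ∈ T)
    (hWD : W ≠ D) (hWD' : W ≠ D') (hDD' : W ⊓ D ≠ W ⊓ D')
    (hno : ∀ p ∈ S, ¬ (p ≤ W ∧ p ≤ D)) (hno' : ∀ p ∈ S, ¬ (p ≤ W ∧ p ≤ D')) :
    HasIndependentPencils 1 1 (affinePoints (projImage f S)) (affineLines (projImage f T)) := by
  have key : ∀ D ∈ T, W ≠ D → (∀ p ∈ S, ¬ (p ≤ W ∧ p ≤ D)) →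
      ¬ (W ⊓ D).map (f : (Fin 3 → ℝ) →ₗ[ℝ] (Fin 3 → ℝ)) ≤ lineAtInfinity →
      HasIndependentPencils 1 1 (affinePoints (projImage f S))
        (affineLines (projImage f T)) := by
    intro D hD hWD hno hfin
    rw [affinePoints_projImage, affineLines_projImage]
    refine ⟨{pushLine f W}, {pushLine f D}, ?_, ?_, Finset.card_singleton _,
      Finset.card_singleton _, ?_, ?_, ?_, ?_⟩
    · simpa using ⟨W, hW, rfl⟩
    · simpa using ⟨D, hD, rfl⟩
    · simp [AffineSubspace.Parallel.refl]
    · simp [AffineSubspace.Parallel.refl]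
    · simp only [Finset.mem_singleton, forall_eq]
      exact fun hp => hWD (injOn_pushLine h hk hf hW hD (pushLine_eq_of_parallel hfin hp))
    · simp only [Finset.mem_singleton, forall_eq, mem_pushLine]
      exact fun x hx => hno _ hx
  by_contra hcon
  have h1 : (W ⊓ D).map (f : (Fin 3 → ℝ) →ₗ[ℝ] (Fin 3 → ℝ)) ≤ lineAtInfinity := by
    by_contra h1
    exact hcon (key D hD hWD hno h1)
  have h2 : (W ⊓ D').map (f : (Fin 3 → ℝ) →ₗ[ℝ] (Fin 3 → ℝ)) ≤ lineAtInfinity := by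
    by_contra h2
    exact hcon (key D' hD' hWD' hno' h2)
  -- If both meets went to infinity, so would all of `W`; but `W` carries points of the
  -- configuration.
  have h3 : W ⊓ D ⊔ W ⊓ D' = W :=
    sup_eq_of_finrank (finrank_inf_of_ne (h.2.1 W hW) (h.2.1 D hD) hWD)
      (finrank_inf_of_ne (h.2.1 W hW) (h.2.1 D' hD') hWD') (h.2.1 W hW) hDD' inf_le_left
      inf_le_left
  have h4 : W.map (f : (Fin 3 → ℝ) →ₗ[ℝ] (Fin 3 → ℝ)) ≤ lineAtInfinity := by
    rw [← h3, Submodule.map_sup]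
    exact sup_le h1 h2
  obtain ⟨x, y, -, hxy⟩ := exists_eq_sup h hk hf hW
  have h5 : ordinaryPoint (x 0) (x 1) ≤ lineAtInfinity := by
    refine le_trans ?_ h4
    rw [← hxy, Submodule.map_sup, pullback, map_map_symm]
    exact le_sup_left
  rw [ordinaryPoint, Submodule.span_singleton_le_iff_mem] at h5
  simp [lineAtInfinity] at h5

end ProjImage

/-! ### A projective transformation in general position -/

/-- The linear automorphism whose last coordinate is `v₀ + t v₁ + t² v₂`. -/
def momentEquiv (t : ℝ) : (Fin 3 → ℝ) ≃ₗ[ℝ] (Fin 3 → ℝ) where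
  toFun v := ![v 1, v 2, v 0 + t * v 1 + t ^ 2 * v 2]
  invFun w := ![w 2 - t * w 0 - t ^ 2 * w 1, w 0, w 1]
  map_add' v w := by
    ext i
    fin_cases i <;> simp
    ring
  map_smul' c v := by
    ext i
    fin_cases i <;> simp
    ring
  left_inv v := by
    ext i
    fin_cases i <;> simp
    ring
  right_inv w := by
    ext i
    fin_cases i <;> simp
    ring

/-- For fixed `v` this is a nonzero polynomial in `t` of degree at most two; hence each nonzero flat
rules out only finitely many parameters of `momentEquiv`. -/
theorem finite_moment_zeros {v : Fin 3 → ℝ} (hv : v ≠ 0) :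
    {t : ℝ | v 0 + t * v 1 + t ^ 2 * v 2 = 0}.Finite := by
  open Polynomial in
  let p : ℝ[X] := C (v 0) + C (v 1) * X + C (v 2) * X ^ 2
  have hp : p ≠ 0 := by
    intro h
    apply hv
    ext i
    have := congrArg (fun q => Polynomial.coeff q i) h
    fin_cases i <;> simpa [p, Polynomial.coeff_X, Polynomial.coeff_C] using this
  refine (Polynomial.finite_setOfPred_isRoot hp).subset fun t ht => ?_
  have ht' : v 0 + t * v 1 + t ^ 2 * v 2 = 0 := ht
  simp only [Set.mem_ofPred_eq, Polynomial.IsRoot, p]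
  simp
  linarith

theorem exists_projective_map_avoiding {F : Set Flat} (hF : F.Finite) (hbot : ∀ q ∈ F, q ≠ ⊥) :
    ∃ f : (Fin 3 → ℝ) ≃ₗ[ℝ] (Fin 3 → ℝ), ∀ q ∈ F,
      ¬ q.map (f : (Fin 3 → ℝ) →ₗ[ℝ] (Fin 3 → ℝ)) ≤ lineAtInfinity := by
  have h : {t : ℝ | ∃ q ∈ F, q.map (momentEquiv t : (Fin 3 → ℝ) →ₗ[ℝ] (Fin 3 → ℝ))
      ≤ lineAtInfinity}.Finite := by
    refine (hF.biUnion (t := fun q => {t : ℝ |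
      q.map (momentEquiv t : (Fin 3 → ℝ) →ₗ[ℝ] (Fin 3 → ℝ)) ≤ lineAtInfinity}) ?_).subset ?_
    · intro q hq
      obtain ⟨v, hv, hv0⟩ := Submodule.exists_mem_ne_zero_of_ne_bot (hbot q hq)
      refine (finite_moment_zeros hv0).subset fun t ht => ?_
      have := ht (Submodule.mem_map_of_mem hv)
      simpa [lineAtInfinity, momentEquiv] using this
    · rintro t ⟨q, hq, ht⟩
      exact Set.mem_biUnion hq ht
  obtain ⟨t, ht⟩ := h.infinite_compl.nonempty
  exact ⟨momentEquiv t, fun q hq hle => ht ⟨q, hq, hle⟩⟩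

theorem exists_projImage_without_parallels {n k : ℕ} {S T : Set Flat}
    (h : IsExtendedConfiguration n k S T) :
    ∃ f : (Fin 3 → ℝ) ≃ₗ[ℝ] (Fin 3 → ℝ), ProjectsIntoPlane f S ∧
      ∀ a ∈ affineLines (projImage f T), ∀ b ∈ affineLines (projImage f T),
        a.Parallel b → a = b := by
  obtain ⟨h1, h2, hS, hT, -⟩ := h
  have hne : ∀ q : Flat, Module.finrank ℝ q = 1 → q ≠ ⊥ := by
    rintro q hq rfl
    simp at hq
  -- Besides the points, all meets of two distinct lines are kept finite, whether or not they belong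
  -- to the configuration.
  obtain ⟨f, hf⟩ := exists_projective_map_avoiding
    (F := S ∪ {q ∈ Set.image2 (· ⊓ ·) T T | Module.finrank ℝ q = 1})
    (hS.union ((hT.image2 _ hT).subset fun q hq => hq.1)) (by
      rintro q (hq | hq)
      · exact hne q (h1 q hq)
      · exact hne q hq.2)
  refine ⟨f, ?_, ?_⟩
  · rintro _ ⟨p, hp, rfl⟩
    exact hf p (Or.inl hp)
  · rw [affineLines_projImage]
    rintro _ ⟨W, hW, rfl⟩ _ ⟨W', hW', rfl⟩ hpar
    by_cases e : W = W'
    · rw [e]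
    · exact pushLine_eq_of_parallel
        (hf _ (Or.inr ⟨⟨W, hW, W', hW', rfl⟩, finrank_inf_of_ne (h2 W hW) (h2 W' hW') e⟩)) hpar

/-! ### Independent pencils -/

theorem center_le_diameter (m : ℕ) (a : ℤ) : ordinaryPoint 0 0 ≤ ln m none a := by
  rw [← diameter_eq_ln]
  exact le_sup_right

theorem not_center_le_ln {m : ℕ} (hm : 11 ≤ m) (a : ℤ) :
    ¬ ordinaryPoint 0 0 ≤ ln m (some 0) a := by
  rw [ordinaryPoint, ln, span_le_lineOf]
  have : 0 < cosMul m 5 := cosMul_pos (by norm_num) (by omega)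
  simp [lineVec, distance, this.ne']

/-- The diameters with the indices `1` and `4` miss all points of the configuration on the line
`(L_0)_0`. -/
theorem no_common_point {ℓ : ℕ} (hℓ : 5 ≤ ℓ) {a : ℤ} (ha : a = 1 ∨ a = 4)
    (k : Option (Fin 5)) (b : ℤ) :
    ¬ (pt (2 * ℓ + 1) k b ≤ ln (2 * ℓ + 1) (some 0) 0 ∧
      pt (2 * ℓ + 1) k b ≤ ln (2 * ℓ + 1) none a) := by
  rw [pt_le_ln_iff hℓ, pt_le_ln_iff hℓ]
  rintro ⟨h1, h2⟩
  have hhalf := two_mul_half ℓ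
  -- These are the diameters through the points on `(L_0)_0`: class 0 has indices 0 and 5, and class
  -- 1 has indices 0 and 1, moved to 2 and 3 by its four half steps. They differ from 1 and 4 by at
  -- most 4, less than the modulus.
  have hne : ∀ c : ℤ, c ∈ ({0, 5, 2, 3} : Finset ℤ) → (a : ZMod (2 * ℓ + 1)) ≠ c := by
    intro c hc e
    rw [ZMod.intCast_eq_intCast_iff_dvd_sub] at e
    obtain ⟨q, hq⟩ := e
    push_cast at hq
    have hq0 : q = 0 := by
      by_contra hq0
      simp only [Finset.mem_insert, Finset.mem_singleton] at hc
      have h3 : |c - a| ≤ 4 := by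
        rw [abs_le]
        omega
      have h4 : 1 ≤ |q| := Int.one_le_abs hq0
      rw [hq, abs_mul, abs_of_nonneg (by omega)] at h3
      nlinarith
    simp only [Finset.mem_insert, Finset.mem_singleton] at hc
    subst hq0
    omega
  cases k with
  | none => simp [voltage] at h2
  | some k =>
    simp only [voltage, Finset.mem_singleton] at h2
    have ha' : (a : ZMod (2 * ℓ + 1)) = b + pointShift k * (ℓ + 1) := by linear_combination -h2
    simp only [voltage] at h1
    split_ifs at h1 with hk hk
    · subst hk
      simp [spanS, pointShift] at h1 ha'
      rcases h1 with h1 | h1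
      · exact hne 0 (by simp) (by rw [ha', h1]; simp)
      · exact hne 5 (by simp) (by rw [ha', h1]; simp)
    · subst hk
      simp [spanT, pointShift] at h1 ha'
      rcases h1 with h1 | h1
      · exact hne 2 (by simp) (by rw [ha', h1]; push_cast; linear_combination 2 * hhalf)
      · exact hne 3 (by simp) (by rw [ha', h1]; push_cast; linear_combination 2 * hhalf)
    · simp at h1

theorem hasIndependentPencils_D5 {ℓ : ℕ} (hℓ : 5 ≤ ℓ) {f : (Fin 3 → ℝ) ≃ₗ[ℝ] (Fin 3 → ℝ)}
    (hf : ProjectsIntoPlane f (D5Points ℓ)) :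
    HasIndependentPencils 1 1 (affinePoints (projImage f (D5Points ℓ)))
      (affineLines (projImage f (D5Lines ℓ))) := by
  have hmem : ∀ j a, ln (2 * ℓ + 1) j a ∈ D5Lines ℓ := fun j a => by
    rw [D5Lines_eq hℓ]
    exact ⟨j, a, rfl⟩
  have hno : ∀ a : ℤ, a = 1 ∨ a = 4 → ∀ p ∈ D5Points ℓ,
      ¬ (p ≤ ln (2 * ℓ + 1) (some 0) 0 ∧ p ≤ ln (2 * ℓ + 1) none a) := by
    rw [D5Points_eq hℓ]
    rintro a ha _ ⟨k, b, rfl⟩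
    exact no_common_point hℓ ha k b
  have hne : ∀ a, ln (2 * ℓ + 1) (some 0) 0 ≠ ln (2 * ℓ + 1) none a := fun a => by
    simp [ln_eq_iff hℓ]
  refine hasIndependentPencils_projImage (isExtendedConfiguration_D5 hℓ) (by norm_num) hf
    (hmem (some 0) 0) (hmem none 1) (hmem none 4) (hne 1) (hne 4) ?_ (hno 1 (Or.inl rfl))
    (hno 4 (Or.inr rfl))
  intro e
  have h14 : ln (2 * ℓ + 1) none 1 ≠ ln (2 * ℓ + 1) none 4 := by
    have h3 := intCast_ne_zero hℓ (n := 3) (by norm_num) (by norm_num)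
    rw [Ne, ln_eq_iff hℓ]
    rintro ⟨-, h⟩
    apply h3
    push_cast at h ⊢
    linear_combination -h
  -- A common meet with both diameters would be the center, which is not on `(L_0)_0`.
  have hcenter : ln (2 * ℓ + 1) none 1 ⊓ ln (2 * ℓ + 1) none 4 = ordinaryPoint 0 0 :=
    inf_eq_of_finrank (finrank_ordinaryPoint 0 0) (finrank_ln _ _ _) (finrank_ln _ _ _) h14
      (center_le_diameter _ _) (center_le_diameter _ _)
  have hle : ln (2 * ℓ + 1) (some 0) 0 ⊓ ln (2 * ℓ + 1) none 1 ≤ ordinaryPoint 0 0 := by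
    rw [← hcenter]
    refine le_inf inf_le_right ?_
    rw [e]
    exact inf_le_right
  have heq := Submodule.eq_of_le_of_finrank_le hle (by
    rw [finrank_ordinaryPoint, finrank_inf_of_ne (finrank_ln _ _ _) (finrank_ln _ _ _) (hne 1)])
  refine not_center_le_ln (m := 2 * ℓ + 1) (by omega) 0 ?_
  rw [← heq]
  exact inf_le_left

end DFive

end

theorem mainTheorem10 (ℓ : ℕ) (hℓ : 5 ≤ ℓ) :
    DFive.IsCelestial (2 * ℓ + 1) DFive.symbolD5 ∧
    DFive.IsExtendedConfiguration (12 * ℓ + 6) 5 (DFive.D5Points ℓ) (DFive.D5Lines ℓ) ∧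
    (∃ f : (Fin 3 → ℝ) ≃ₗ[ℝ] (Fin 3 → ℝ), DFive.ProjectsIntoPlane f (DFive.D5Points ℓ) ∧
      ∀ a ∈ DFive.affineLines (DFive.projImage f (DFive.D5Lines ℓ)),
      ∀ b ∈ DFive.affineLines (DFive.projImage f (DFive.D5Lines ℓ)), a.Parallel b → a = b) ∧
    (∀ f : (Fin 3 → ℝ) ≃ₗ[ℝ] (Fin 3 → ℝ), DFive.ProjectsIntoPlane f (DFive.D5Points ℓ) →
      DFive.IsGeometricConfiguration (12 * ℓ + 6) 5
        (DFive.affinePoints (DFive.projImage f (DFive.D5Points ℓ)))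
        (DFive.affineLines (DFive.projImage f (DFive.D5Lines ℓ))) ∧
      DFive.HasIndependentPencils 1 1
        (DFive.affinePoints (DFive.projImage f (DFive.D5Points ℓ)))
        (DFive.affineLines (DFive.projImage f (DFive.D5Lines ℓ)))) := by
  have h := DFive.isExtendedConfiguration_D5 hℓ
  exact ⟨DFive.isCelestial_symbolD5 hℓ, h, DFive.exists_projImage_without_parallels h,
    fun f hf => ⟨DFive.isGeometricConfiguration_projImage h (by norm_num) hf,
      DFive.hasIndependentPencils_D5 hℓ hf⟩⟩
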